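/- **Setting.** Let $L=\{L(y):y\ge 0\}$ be an increasing additive process (IAP) on a probability space $(\Omega,\mathcal F,P)$: $L(0)=0$ a.s., $L$ has independent increments, and its paths are a.s. nondecreasing and right-continuous. Let $\{\nu(y,dv):y\ge 0\}$ be its family of Lévy measures on $(0,\infty)$, i.e. $\int \min(1,v)\,\nu(y,dv)<\infty$ and $E[e^{-\lambda L(y)}]=\exp\{-\int_0^\infty(1-e^{-\lambda v})\,\nu(y,dv)\}$ for all $y,\lambda\ge 0$. Let $\alpha$ be a nonzero finite measure on $\mathbb R$ with distribution function $A(x)=\alpha((-\infty,x])$, put $L_A(x)=L(A(x))$, $\nu_\alpha(x,dv)=\nu(A(x),dv)$, and let $\tilde\nu_\alpha$ be the measure on $\mathbb R\times(0,\infty)$ with $\tilde\nu_\alpha((-\infty,x]\times C)=\nu_\alpha(x,C)$ for all $x\in\mathbb R$ and Borel $C\subset(0,\infty)$. Let $k:\mathbb R\times\mathbb R\to[0,\infty)$ be such that $x\mapsto k(t,x)$ is measurable for every $t$, and, with $\bar k(x):=\lim_{t\to+\infty}k(t,x)$, - (I) for every $x$, $t\mapsto k(t,x)$ is nondecreasing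 and right-continuous with $\lim_{t\to-\infty}k(t,x)=0$; - (II) $\bar k(x)<\infty$ for $\tilde\nu_\alpha$-almost every $(x,v)$, and $\int_{\mathbb R\times(0,\infty)}[1-\exp\{-\lambda v\bar k(x)\}]\,\tilde\nu_\alpha(dx\,dv)<\infty$ for every $\lambda>0$; - (III) $\tilde\nu_\alpha(\mathbb R\times(0,\infty))=\infty$. Put $Z(t)=\int_{\mathbb R}k(t,x)\,dL_A(x)$, $\bar Z=\lim_{t\to+\infty}Z(t)$ and $F(t)=Z(t)/\bar Z$ (with $F=0$ on the event $\bar Z=0$); $F$ is the normalized IAP driven random distribution function. Assume that $F$ admits a density, i.e. almost every path of $F$ is absolutely continuous with respect to Lebesgue measure. **Proposition.** Let $g:\mathbb R\to\mathbb R$ be measurable and set $\tilde h(x):=\int_{\mathbb R}|g(t)|\,k'(t,x)\,dt\in[0,\infty]$, where $k'(t,x)=\frac{\partial}{\partial t}k(t,x)$ (which exists for almost every $t$). Then $\int_{\mathbb R}|g(t)|\,dF(t)<\infty$ a.s. $[P]$ if and only if $\tilde h(x)<\infty$ for $\tilde\nu_\alpha$-almost every $(x,v)$ and $$\int_{\mathbb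 R\times(0,\infty)}\bigl[1-\exp(-\lambda v\tilde h(x))\bigr]\,\tilde\nu_\alpha(dx\,dv)<\infty\qquad\text{for every }\lambda>0,$$ where $1-\exp(-\infty)=1$. (In particular, if $\tilde h$ is finite everywhere, the first condition holds automatically and the integral condition alone is necessary and sufficient.) -/

import Mathlib

open MeasureTheory ProbabilityTheory Filter Set Topology
open scoped ENNReal NNReal

noncomputable section

namespace IAP

/-- The Lebesgue–Stieltjes measure `df` of a nondecreasing function `f : ℝ → ℝ`
(and `0` if `f` is not nondecreasing). -/
def lsMeasure (f : ℝ → ℝ) : Measure ℝ :=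
  open Classical in if h : Monotone f then h.stieltjesFunction.measure else 0

/-- The quantity `1 - exp (-u)` for `u ∈ [0, ∞]`; it equals `1` at `u = ∞`. -/
def oneSubExpNeg (u : ℝ≥0∞) : ℝ≥0∞ := 1 - EReal.exp (-(u : EReal))

/-- `L = {L(y) : y ≥ 0}` is an increasing additive process on `(Ω, P)`: it starts at `0`, has
independent increments, and almost all its paths are nondecreasing and right-continuous. -/
structure IsIncreasingAdditive {Ω : Type*} [MeasurableSpace Ω] (P : Measure Ω)
    (L : ℝ≥0 → Ω → ℝ) : Prop where
  measurable : ∀ y, Measurable (L y)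
  start : ∀ᵐ ω ∂P, L 0 ω = 0
  indep : HasIndepIncrements L P
  mono : ∀ᵐ ω ∂P, Monotone fun y => L y ω
  rightCont : ∀ᵐ ω ∂P, ∀ y, ContinuousWithinAt (fun y => L y ω) (Ici y) y

/-- `ν(y, dv)`, `y ≥ 0`, is the family of Lévy measures on `(0, ∞)` of the increasing process `L`:
`∫ min(1, v) ν(y, dv) < ∞` and
`E[exp (-λ L(y))] = exp (-∫ (1 - exp (-λ v)) ν(y, dv))` for all `λ ≥ 0`. -/
structure HasLevyMeasures {Ω : Type*} [MeasurableSpace Ω] (P : Measure Ω)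
    (L : ℝ≥0 → Ω → ℝ) (ν : ℝ≥0 → Measure (Ioi (0 : ℝ))) : Prop where
  levy : ∀ y, ∫⁻ v, ENNReal.ofReal (min 1 (v : ℝ)) ∂(ν y) < ∞
  laplace : ∀ y, ∀ l : ℝ, 0 ≤ l →
    ∫ ω, Real.exp (-(l * L y ω)) ∂P =
      Real.exp (-∫ v : Ioi (0 : ℝ), (1 - Real.exp (-(l * (v : ℝ)))) ∂(ν y))

/-- The distribution function `A(x) = α((-∞, x])` of a finite measure `α` on `ℝ`. -/
def distFun (α : Measure ℝ) (x : ℝ) : ℝ≥0 := (α (Iic x)).toNNReal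

/-- The time-changed process `L_A(x) = L(A(x))`, `x ∈ ℝ`. -/
def timeChange {Ω : Type*} (L : ℝ≥0 → Ω → ℝ) (α : Measure ℝ) (x : ℝ) (ω : Ω) : ℝ :=
  L (distFun α x) ω

/-- `νt` is the Poisson intensity measure on `ℝ × (0, ∞)` of `L_A`:
`νt((-∞, x] × C) = ν_α(x, C)`, where `ν_α(x, dv) = ν(A(x), dv)` is the Lévy measure of `L_A(x)`. -/
def IsPoissonIntensity (ν : ℝ≥0 → Measure (Ioi (0 : ℝ))) (α : Measure ℝ)
    (νt : Measure (ℝ × Ioi (0 : ℝ))) : Prop :=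
  ∀ (x : ℝ) (C : Set (Ioi (0 : ℝ))), MeasurableSet C → νt (Iic x ×ˢ C) = ν (distFun α x) C

/-- `Z(t) = ∫ k(t, x) dL_A(x) ∈ [0, ∞]`, a pathwise Lebesgue–Stieltjes integral. -/
def drivenDF {Ω : Type*} (L : ℝ≥0 → Ω → ℝ) (α : Measure ℝ) (k : ℝ → ℝ → ℝ)
    (t : ℝ) (ω : Ω) : ℝ≥0∞ :=
  ∫⁻ x, ENNReal.ofReal (k t x) ∂(lsMeasure fun x => timeChange L α x ω)

/-- `Zbar = lim_{t → ∞} Z(t)`, written as a supremum because `Z` is nondecreasing. -/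
def drivenTotal {Ω : Type*} (L : ℝ≥0 → Ω → ℝ) (α : Measure ℝ) (k : ℝ → ℝ → ℝ)
    (ω : Ω) : ℝ≥0∞ :=
  ⨆ t, drivenDF L α k t ω

/-- The normalized random distribution function `F(t) = Z(t) / Zbar`
(by convention `0` on the event `Zbar = 0`). -/
def normalizedDF {Ω : Type*} (L : ℝ≥0 → Ω → ℝ) (α : Measure ℝ) (k : ℝ → ℝ → ℝ)
    (t : ℝ) (ω : Ω) : ℝ :=
  (drivenDF L α k t ω / drivenTotal L α k ω).toReal

/-- `kbar(x) = lim_{t → ∞} k(t, x) ∈ [0, ∞]`, written as a supremum because `t ↦ k(t, x)` is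
nondecreasing. -/
def kbar (k : ℝ → ℝ → ℝ) (x : ℝ) : ℝ≥0∞ := ⨆ t, ENNReal.ofReal (k t x)

/-- The function `∫ |g(t)| k'(t, x) dt ∈ [0, ∞]`, where `k'` is the derivative of `k` in its first
argument; for nondecreasing `t ↦ k(t, x)` it exists at almost every `t`. -/
def hTilde (k : ℝ → ℝ → ℝ) (g : ℝ → ℝ) (x : ℝ) : ℝ≥0∞ :=
  ∫⁻ t, ‖g t‖ₑ * ENNReal.ofReal (deriv (fun s => k s x) t)

/-- The conditions on `k` and `νt` under which `Z` and `F` are considered. Nonnegativity of `k`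
follows from `mono` and `atBot`. -/
structure IsAdmissible (k : ℝ → ℝ → ℝ) (νt : Measure (ℝ × Ioi (0 : ℝ))) : Prop where
  measurable : ∀ t, Measurable (k t)
  mono : ∀ x, Monotone fun t => k t x
  rightCont : ∀ x t, ContinuousWithinAt (fun t => k t x) (Ici t) t
  atBot : ∀ x, Tendsto (fun t => k t x) atBot (𝓝 0)
  kbar_lt_top : ∀ᵐ p ∂νt, kbar k p.1 < ∞
  integral_lt_top : ∀ l : ℝ, 0 < l →
    ∫⁻ p, oneSubExpNeg (ENNReal.ofReal (l * (p.2 : ℝ)) * kbar k p.1) ∂νt < ∞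
  mass_eq_top : νt univ = ∞

end IAP

end

/-! Let κ be the random measure dL_A. By independence of increments for step functions, and by
limits for all measurable f ≥ 0, its Laplace functional is E exp(-∫ f dκ) = exp(-∫ (1 - e^{-v f(x)})
νt(dx dv)) (`laplaceIdentity`). Replacing f by c f and letting c → 0 turns E exp(-c ∫ f dκ) into P(∫
f dκ < ∞), whence a criterion for ∫ f dκ < ∞ a.s. (`ae_lintegral_lt_top_iff`). For f = `kbar k` the
criterion says that Zbar is a.s. finite; for f = `hTilde k g` it is the right-hand side of the
proposition. It remains to show, path by path, that ∫ |g| dF and ∫ `hTilde k g` dκ are finite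
together (`lintegral_normalized_lt_top_iff`).

Formally Zbar dF(t) = (∫ k'(t, x) κ(dx)) dt, and Tonelli concludes. But a mixture can be absolutely
continuous without its components being so: Dirac masses at x, mixed over Lebesgue measure, give
Lebesgue measure. This cannot happen when κ is a sum of atoms, because each κ{s} k(dt, s) is then
dominated by Zbar dF. Pure atomicity (`ae_ae_singleton_ne_zero`) expresses that the Laplace exponent
has no drift: the exponent at l, divided by l, tends to 0 as l → ∞, and this quotient bounds the
mean of the diffuse mass. -/

noncomputable section

namespace IAP

/-! ### The functions `exp (-u)` and `1 - exp (-u)` on `[0, ∞]` -/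

section

/-- The function `exp (-u)` for `u ∈ [0, ∞]`. -/
def expNeg (u : ℝ≥0∞) : ℝ≥0∞ := EReal.exp (-(u : EReal))

lemma expNeg_zero : expNeg 0 = 1 := by simp [expNeg]

lemma expNeg_top : expNeg ∞ = 0 := by simp [expNeg]

lemma antitone_expNeg : Antitone expNeg := fun a b h => by
  simp only [expNeg, EReal.exp_le_exp_iff, EReal.neg_le_neg_iff]
  exact_mod_cast h

lemma injective_expNeg : Function.Injective expNeg := fun a b h => by
  have := EReal.exp_strictMono.injective h
  simpa using this

lemma expNeg_le_one (u : ℝ≥0∞) : expNeg u ≤ 1 := by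
  rw [← expNeg_zero]; exact antitone_expNeg zero_le

lemma expNeg_ne_top (u : ℝ≥0∞) : expNeg u ≠ ∞ :=
  ((expNeg_le_one u).trans_lt ENNReal.one_lt_top).ne

lemma expNeg_eq_zero_iff {u : ℝ≥0∞} : expNeg u = 0 ↔ u = ∞ := by
  rw [← expNeg_top, injective_expNeg.eq_iff]

lemma expNeg_eq_one_iff {u : ℝ≥0∞} : expNeg u = 1 ↔ u = 0 := by
  rw [← expNeg_zero, injective_expNeg.eq_iff]

lemma expNeg_ofReal {x : ℝ} (hx : 0 ≤ x) :
    expNeg (ENNReal.ofReal x) = ENNReal.ofReal (Real.exp (-x)) := by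
  rw [expNeg, EReal.coe_ennreal_ofReal, max_eq_left hx, ← EReal.coe_neg, EReal.exp_coe]

lemma expNeg_add (u v : ℝ≥0∞) : expNeg (u + v) = expNeg u * expNeg v := by
  rw [expNeg, expNeg, expNeg, ← EReal.exp_add, EReal.coe_ennreal_add, EReal.neg_add,
    sub_eq_add_neg]
  · exact Or.inl (EReal.coe_ennreal_ne_bot u)
  · exact Or.inr (EReal.coe_ennreal_ne_bot v)

lemma expNeg_sum {ι : Type*} (s : Finset ι) (f : ι → ℝ≥0∞) :
    expNeg (∑ i ∈ s, f i) = ∏ i ∈ s, expNeg (f i) := by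
  classical
  induction s using Finset.induction_on with
  | empty => simp [expNeg_zero]
  | insert a s ha ih => rw [Finset.sum_insert ha, Finset.prod_insert ha, expNeg_add, ih]

lemma continuous_expNeg : Continuous expNeg :=
  EReal.expHomeomorph.continuous.comp (continuous_neg.comp continuous_coe_ennreal_ereal)

lemma measurable_expNeg : Measurable expNeg := continuous_expNeg.measurable

lemma oneSubExpNeg_eq (u : ℝ≥0∞) : oneSubExpNeg u = 1 - expNeg u := rfl

lemma oneSubExpNeg_zero : oneSubExpNeg 0 = 0 := by simp [oneSubExpNeg_eq, expNeg_zero]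

lemma oneSubExpNeg_top : oneSubExpNeg ∞ = 1 := by simp [oneSubExpNeg_eq, expNeg_top]

lemma oneSubExpNeg_add_expNeg (u : ℝ≥0∞) : oneSubExpNeg u + expNeg u = 1 :=
  tsub_add_cancel_of_le (expNeg_le_one u)

lemma monotone_oneSubExpNeg : Monotone oneSubExpNeg := fun _ _ h =>
  tsub_le_tsub_left (antitone_expNeg h) 1

lemma oneSubExpNeg_le_one (u : ℝ≥0∞) : oneSubExpNeg u ≤ 1 := tsub_le_self

lemma continuous_oneSubExpNeg : Continuous oneSubExpNeg :=
  ENNReal.continuous_sub_left ENNReal.one_ne_top |>.comp continuous_expNeg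

lemma measurable_oneSubExpNeg : Measurable oneSubExpNeg := continuous_oneSubExpNeg.measurable

lemma oneSubExpNeg_ofReal {x : ℝ} (hx : 0 ≤ x) :
    oneSubExpNeg (ENNReal.ofReal x) = ENNReal.ofReal (1 - Real.exp (-x)) := by
  rw [oneSubExpNeg_eq, expNeg_ofReal hx, ENNReal.ofReal_sub _ (Real.exp_pos _).le,
    ENNReal.ofReal_one]

lemma oneSubExpNeg_le_self (u : ℝ≥0∞) : oneSubExpNeg u ≤ u := by
  induction u with
  | top => simp
  | coe x =>
    rw [← ENNReal.ofReal_coe_nnreal, oneSubExpNeg_ofReal x.coe_nonneg]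
    exact ENNReal.ofReal_le_ofReal (by linarith [Real.add_one_le_exp (-(x : ℝ))])

/-- This is 1 + u ≤ e^u multiplied by e^{-u}. It makes the control measure finite and bounds the
diffuse mass by cell sums. -/
lemma mul_expNeg_le_oneSubExpNeg (u : ℝ≥0∞) : u * expNeg u ≤ oneSubExpNeg u := by
  induction u with
  | top => simp [expNeg_top]
  | coe x =>
    rw [← ENNReal.ofReal_coe_nnreal, oneSubExpNeg_ofReal x.coe_nonneg, expNeg_ofReal x.coe_nonneg,
      ← ENNReal.ofReal_mul x.coe_nonneg]
    refine ENNReal.ofReal_le_ofReal ?_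
    have h1 := Real.add_one_le_exp (x : ℝ)
    have h2 := Real.exp_pos (-(x : ℝ))
    have h3 : Real.exp (x : ℝ) * Real.exp (-(x : ℝ)) = 1 := by rw [← Real.exp_add]; simp
    nlinarith

/-- Iterated subadditivity of 1 - e^{-u}. It supplies a dominating function, uniform in n, for (1 -
e^{-nu}) / n. -/
lemma oneSubExpNeg_natCast_mul_le (n : ℕ) (u : ℝ≥0∞) :
    oneSubExpNeg (n * u) ≤ n * oneSubExpNeg u := by
  induction n with
  | zero => simp [oneSubExpNeg_zero]
  | succ n ih =>
    have key : ∀ a b, oneSubExpNeg (a + b) ≤ oneSubExpNeg a + oneSubExpNeg b := by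
      intro a b
      rw [oneSubExpNeg_eq, tsub_le_iff_right, expNeg_add]
      calc (1 : ℝ≥0∞) = oneSubExpNeg a + expNeg a * (oneSubExpNeg b + expNeg b) := by
            rw [oneSubExpNeg_add_expNeg, mul_one, oneSubExpNeg_add_expNeg]
        _ = oneSubExpNeg a + expNeg a * oneSubExpNeg b + expNeg a * expNeg b := by ring
        _ ≤ _ := by
            gcongr
            exact mul_le_of_le_one_left' (expNeg_le_one a)
    push_cast
    rw [add_mul, add_mul, one_mul, one_mul]
    exact (key _ _).trans (by gcongr)

end

/-! ### The random measure `dL_A` -/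

section

lemma lsMeasure_of_monotone {f : ℝ → ℝ} (hf : Monotone f) :
    lsMeasure f = hf.stieltjesFunction.measure := dif_pos hf

lemma stieltjesFunction_apply_of_rightCont {f : ℝ → ℝ} (hf : Monotone f)
    (hc : ∀ x, ContinuousWithinAt f (Ici x) x) (x : ℝ) : hf.stieltjesFunction x = f x := by
  rw [hf.stieltjesFunction_eq]
  exact hf.continuousWithinAt_Ioi_iff_rightLim_eq.1 ((hc x).mono Ioi_subset_Ici_self)

lemma lsMeasure_Ioc {f : ℝ → ℝ} (hf : Monotone f)
    (hc : ∀ x, ContinuousWithinAt f (Ici x) x) (a b : ℝ) :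
    lsMeasure f (Ioc a b) = ENNReal.ofReal (f b - f a) := by
  rw [lsMeasure_of_monotone hf, StieltjesFunction.measure_Ioc,
    stieltjesFunction_apply_of_rightCont hf hc, stieltjesFunction_apply_of_rightCont hf hc]

lemma lsMeasure_Iic {f : ℝ → ℝ} (hf : Monotone f)
    (hc : ∀ x, ContinuousWithinAt f (Ici x) x) {l : ℝ} (hl : Tendsto f atBot (𝓝 l)) (x : ℝ) :
    lsMeasure f (Iic x) = ENNReal.ofReal (f x - l) := by
  have : (hf.stieltjesFunction : ℝ → ℝ) = f :=
    funext (stieltjesFunction_apply_of_rightCont hf hc)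
  rw [lsMeasure_of_monotone hf, StieltjesFunction.measure_Iic (l := l) _ (by rwa [this]), this]

instance isLocallyFiniteMeasure_lsMeasure (f : ℝ → ℝ) : IsLocallyFiniteMeasure (lsMeasure f) := by
  unfold lsMeasure
  split_ifs <;> infer_instance

lemma monotone_distFun (α : Measure ℝ) [IsFiniteMeasure α] : Monotone (distFun α) := fun _ _ h =>
  ENNReal.toNNReal_mono (measure_ne_top _ _) (measure_mono (Iic_subset_Iic.2 h))

lemma tendsto_distFun_atBot (α : Measure ℝ) [IsFiniteMeasure α] :
    Tendsto (distFun α) atBot (𝓝 0) := by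
  have h := tendsto_measure_iInter_atBot (μ := α) (s := fun x : ℝ => Iic x)
    (fun _ => nullMeasurableSet_Iic) monotone_Iic ⟨0, measure_ne_top _ _⟩
  have h0 : ⋂ x : ℝ, Iic x = ∅ := by
    ext y
    simpa using ⟨y - 1, by linarith⟩
  rw [h0, measure_empty] at h
  exact (ENNReal.tendsto_toNNReal ENNReal.zero_ne_top).comp h

lemma rightCont_distFun (α : Measure ℝ) [IsFiniteMeasure α] (x : ℝ) :
    ContinuousWithinAt (distFun α) (Ici x) x := by
  rw [← continuousWithinAt_Ioi_iff_Ici]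
  have h := tendsto_measure_biInter_gt (μ := α) (s := fun x : ℝ => Iic x) (a := x)
    (fun _ _ => nullMeasurableSet_Iic) (fun i j _ h => Iic_subset_Iic.2 h)
    ⟨x + 1, by simp, measure_ne_top _ _⟩
  have h0 : ⋂ r > x, Iic r = Iic x := by
    ext y
    simpa using forall_gt_imp_ge_iff_le_of_dense
  rw [h0] at h
  exact (ENNReal.tendsto_toNNReal (measure_ne_top _ _)).comp h

variable {Ω : Type*} [MeasurableSpace Ω] {P : Measure Ω} {L : ℝ≥0 → Ω → ℝ}

/-- A measurable version of the random measure `dL_A`. -/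
structure IsRandomMeasureVersion (P : Measure Ω) (L : ℝ≥0 → Ω → ℝ) (α : Measure ℝ)
    (κ : Ω → Measure ℝ) : Prop where
  measurable : Measurable κ
  finite : ∀ ω, IsFiniteMeasure (κ ω)
  ae_eq : ∀ᵐ ω ∂P, κ ω = lsMeasure fun x => timeChange L α x ω
  ae_Iic : ∀ᵐ ω ∂P, ∀ x, κ ω (Iic x) = ENNReal.ofReal (timeChange L α x ω)
  ae_Ioc : ∀ᵐ ω ∂P, ∀ a b, κ ω (Ioc a b) =
    ENNReal.ofReal (timeChange L α b ω - timeChange L α a ω)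

/-- The bad paths lie in a measurable null set `N`. Setting κ = 0 there makes κ measurable and
finite everywhere, so it can be used as a kernel. -/
lemma IsIncreasingAdditive.exists_version (hL : IsIncreasingAdditive P L)
    (α : Measure ℝ) [IsFiniteMeasure α] : ∃ κ, IsRandomMeasureVersion P L α κ := by
  classical
  have hgood : ∀ᵐ ω ∂P, L 0 ω = 0 ∧ (Monotone fun y => L y ω) ∧
      ∀ y, ContinuousWithinAt (fun y => L y ω) (Ici y) y := by
    filter_upwards [hL.start, hL.mono, hL.rightCont] with ω h1 h2 h3 using ⟨h1, h2, h3⟩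
  obtain ⟨N, hNsub, hN, hN0⟩ := exists_measurable_superset_of_null (ae_iff.1 hgood)
  have hg : ∀ ω, ω ∉ N → L 0 ω = 0 ∧ (Monotone fun y => L y ω) ∧
      ∀ y, ContinuousWithinAt (fun y => L y ω) (Ici y) y := fun ω hω => by
    by_contra h
    exact hω (hNsub h)
  have hmono : ∀ ω, ω ∉ N → Monotone fun x => timeChange L α x ω := fun ω hω =>
    (hg ω hω).2.1.comp (monotone_distFun α)
  have hcont : ∀ ω, ω ∉ N → ∀ x, ContinuousWithinAt (fun x => timeChange L α x ω) (Ici x) x :=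
    fun ω hω x => ContinuousWithinAt.comp (t := Ici (distFun α x)) ((hg ω hω).2.2 (distFun α x))
      (rightCont_distFun α x) (fun y hy => monotone_distFun α hy)
  have hlim : ∀ ω, ω ∉ N → Tendsto (fun x => timeChange L α x ω) atBot (𝓝 0) := fun ω hω => by
    have h := (hg ω hω).2.2 0
    -- In `ℝ≥0`, right-continuity at 0 is plain continuity; hence L_A tends to L(0) = 0 at -∞ and
    -- κ(Iic x) is exactly L_A(x).
    have hI : Ici (0 : ℝ≥0) = univ := by ext; simp
    rw [hI, continuousWithinAt_univ] at h
    have h' := h.tendsto.comp (tendsto_distFun_atBot α)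
    simp only [(hg ω hω).1] at h'
    exact h'
  let κ : Ω → Measure ℝ := fun ω => if ω ∈ N then 0 else lsMeasure fun x => timeChange L α x ω
  have hκ : ∀ ω, ω ∉ N → κ ω = lsMeasure fun x => timeChange L α x ω := fun ω hω => if_neg hω
  have hIic : ∀ ω, ω ∉ N → ∀ x, κ ω (Iic x) = ENNReal.ofReal (timeChange L α x ω) :=
    fun ω hω x => by rw [hκ ω hω, lsMeasure_Iic (hmono ω hω) (hcont ω hω) (hlim ω hω), sub_zero]
  have hfin : ∀ ω, IsFiniteMeasure (κ ω) := fun ω => by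
    by_cases hω : ω ∈ N
    · simp only [κ, hω, if_true]; infer_instance
    · refine ⟨lt_of_le_of_lt (?_ : κ ω univ ≤ ENNReal.ofReal (L (α univ).toNNReal ω))
        ENNReal.ofReal_lt_top⟩
      refine le_of_tendsto' (tendsto_measure_Iic_atTop (κ ω)) fun x => ?_
      rw [hIic ω hω x]
      exact ENNReal.ofReal_le_ofReal ((hg ω hω).2.1
        (ENNReal.toNNReal_mono (measure_ne_top _ _) (measure_mono (subset_univ _))))
  have hmeasIic : ∀ x, Measurable fun ω => κ ω (Iic x) := fun x => by
    have : (fun ω => κ ω (Iic x)) =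
        fun ω => if ω ∈ N then 0 else ENNReal.ofReal (timeChange L α x ω) := by
      funext ω
      by_cases hω : ω ∈ N
      · simp [κ, hω]
      · rw [hIic ω hω, if_neg hω]
    rw [this]
    exact Measurable.ite hN measurable_const (hL.measurable _).ennreal_ofReal
  have hae : ∀ᵐ ω ∂P, ω ∉ N := measure_eq_zero_iff_ae_notMem.1 hN0
  refine ⟨κ, ?_, hfin, ?_, ?_, ?_⟩
  · refine Measurable.measure_of_isPiSystem (borel_eq_generateFrom_Iic ℝ ▸ BorelSpace.measurable_eq)
      isPiSystem_Iic ?_ ?_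
    · rintro _ ⟨x, rfl⟩
      exact hmeasIic x
    · exact measurable_of_tendsto_metrizable (f := fun (n : ℕ) ω => κ ω (Iic (n : ℝ)))
        (fun n => hmeasIic n) (tendsto_pi_nhds.2 fun ω =>
          (tendsto_measure_Iic_atTop (κ ω)).comp tendsto_natCast_atTop_atTop)
  · filter_upwards [hae] with ω hω using hκ ω hω
  · filter_upwards [hae] with ω hω using hIic ω hω
  · filter_upwards [hae] with ω hω a b
    rw [hκ ω hω, lsMeasure_Ioc (hmono ω hω) (hcont ω hω)]

end

/-! ### Laplace transforms of increments -/

section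

/-- The Laplace exponent `∫ (1 - exp (-v f(x))) νt(dx dv)` of a nonnegative function `f`. -/
def laplaceExponent (νt : Measure (ℝ × Ioi (0 : ℝ))) (f : ℝ → ℝ≥0∞) : ℝ≥0∞ :=
  ∫⁻ p, oneSubExpNeg (ENNReal.ofReal (p.2 : ℝ) * f p.1) ∂νt

/-- The Laplace exponent of the constant `c`, restricted to `B ⊆ ℝ`. -/
def exponentOn (νt : Measure (ℝ × Ioi (0 : ℝ))) (c : ℝ≥0) (B : Set ℝ) : ℝ≥0∞ :=
  ∫⁻ p in B ×ˢ univ, oneSubExpNeg (ENNReal.ofReal (p.2 : ℝ) * c) ∂νt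

lemma measurable_ofReal_snd :
    Measurable fun p : ℝ × Ioi (0 : ℝ) => ENNReal.ofReal (p.2 : ℝ) :=
  (measurable_subtype_coe.comp measurable_snd).ennreal_ofReal

lemma measurable_oneSubExpNeg_mul {f : ℝ → ℝ≥0∞} (hf : Measurable f) :
    Measurable fun p : ℝ × Ioi (0 : ℝ) => oneSubExpNeg (ENNReal.ofReal (p.2 : ℝ) * f p.1) :=
  measurable_oneSubExpNeg.comp (measurable_ofReal_snd.mul (hf.comp measurable_fst))

lemma measurable_oneSubExpNeg_mul_const (c : ℝ≥0∞) :
    Measurable fun p : ℝ × Ioi (0 : ℝ) => oneSubExpNeg (ENNReal.ofReal (p.2 : ℝ) * c) :=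
  measurable_oneSubExpNeg_mul measurable_const

lemma exponentOn_union {νt : Measure (ℝ × Ioi (0 : ℝ))} (c : ℝ≥0) {A B : Set ℝ}
    (hB : MeasurableSet B) (h : Disjoint A B) :
    exponentOn νt c (A ∪ B) = exponentOn νt c A + exponentOn νt c B := by
  rw [exponentOn, union_prod, lintegral_union (hB.prod MeasurableSet.univ)]
  · rfl
  · exact h.set_prod_left _ _

variable {Ω : Type*} [MeasurableSpace Ω] {P : Measure Ω} {L : ℝ≥0 → Ω → ℝ}
  {ν : ℝ≥0 → Measure (Ioi (0 : ℝ))} {α : Measure ℝ} {νt : Measure (ℝ × Ioi (0 : ℝ))}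
  {κ : Ω → Measure ℝ}

lemma IsPoissonIntensity.map_snd_restrict (hνt : IsPoissonIntensity ν α νt) (x : ℝ) :
    (νt.restrict (Iic x ×ˢ univ)).map Prod.snd = ν (distFun α x) := by
  ext C hC
  rw [Measure.map_apply measurable_snd hC, Measure.restrict_apply (measurable_snd hC), ← hνt x C hC]
  congr 1
  ext p
  simp [and_comm]

lemma IsPoissonIntensity.exponentOn_Iic (hνt : IsPoissonIntensity ν α νt) (c : ℝ≥0) (x : ℝ) :
    exponentOn νt c (Iic x) =
      ∫⁻ v, oneSubExpNeg (ENNReal.ofReal (v : ℝ) * c) ∂ν (distFun α x) := by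
  rw [← hνt.map_snd_restrict x, lintegral_map _ measurable_snd]
  · rfl
  · exact measurable_oneSubExpNeg.comp
      ((measurable_subtype_coe.ennreal_ofReal).mul measurable_const)

lemma ofReal_mul_coe_eq (c : ℝ≥0) (v : ℝ) :
    ENNReal.ofReal v * c = ENNReal.ofReal (c * v) := by
  rw [← ENNReal.ofReal_coe_nnreal, mul_comm, ENNReal.ofReal_mul c.coe_nonneg]

lemma oneSubExpNeg_mul_le_min (c : ℝ≥0) (v : ℝ) :
    oneSubExpNeg (ENNReal.ofReal v * c) ≤ (c + 1) * ENNReal.ofReal (min 1 v) := by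
  rcases le_total 1 v with h | h
  · rw [min_eq_left h, ENNReal.ofReal_one, mul_one]
    exact (oneSubExpNeg_le_one _).trans (by simp)
  · rw [min_eq_right h, mul_comm (ENNReal.ofReal v)]
    exact (oneSubExpNeg_le_self _).trans (by gcongr; simp)

lemma HasLevyMeasures.exponent_lt_top (hν : HasLevyMeasures P L ν) (c : ℝ≥0) (y : ℝ≥0) :
    ∫⁻ v, oneSubExpNeg (ENNReal.ofReal (v : ℝ) * c) ∂ν y < ∞ := by
  calc _ ≤ ∫⁻ v : Ioi (0 : ℝ), (c + 1) * ENNReal.ofReal (min 1 (v : ℝ)) ∂ν y :=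
        lintegral_mono fun v => oneSubExpNeg_mul_le_min c v
    _ = (c + 1) * ∫⁻ v : Ioi (0 : ℝ), ENNReal.ofReal (min 1 (v : ℝ)) ∂ν y :=
        lintegral_const_mul _ (by fun_prop)
    _ < ∞ := ENNReal.mul_lt_top (by simp) (hν.levy y)

/-- Transfers `HasLevyMeasures.laplace` from Bochner integrals to `ℝ≥0∞`. Both integrands are
integrable, so neither Bochner integral takes its default value 0. -/
lemma lintegral_expNeg_eq [IsProbabilityMeasure P] (hL : IsIncreasingAdditive P L)
    (hν : HasLevyMeasures P L ν) (c y : ℝ≥0) :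
    ∫⁻ ω, expNeg (c * ENNReal.ofReal (L y ω)) ∂P =
      expNeg (∫⁻ v, oneSubExpNeg (ENNReal.ofReal (v : ℝ) * c) ∂ν y) := by
  have hpos : ∀ᵐ ω ∂P, 0 ≤ L y ω := by
    filter_upwards [hL.start, hL.mono] with ω h0 hm
    rw [← h0]
    exact hm (zero_le : 0 ≤ y)
  have h1 : ∀ᵐ ω ∂P, expNeg (c * ENNReal.ofReal (L y ω)) =
      ENNReal.ofReal (Real.exp (-(c * L y ω))) := by
    filter_upwards [hpos] with ω hω
    rw [mul_comm, ofReal_mul_coe_eq, expNeg_ofReal (by positivity)]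
  have hint : Integrable (fun ω => Real.exp (-(c * L y ω))) P := by
    refine Integrable.of_bound (C := 1)
      (((hL.measurable y).const_mul _).neg.exp).aestronglyMeasurable ?_
    filter_upwards [hpos] with ω hω
    rw [Real.norm_eq_abs, Real.abs_exp, Real.exp_le_one_iff]
    have : 0 ≤ c * L y ω := by positivity
    linarith
  have hone : ∀ v : Ioi (0 : ℝ), oneSubExpNeg (ENNReal.ofReal (v : ℝ) * c) =
      ENNReal.ofReal (1 - Real.exp (-(c * (v : ℝ)))) := fun v => by
    have := v.2.out.le
    rw [ofReal_mul_coe_eq, oneSubExpNeg_ofReal (by positivity)]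
  have hnn : ∀ v : Ioi (0 : ℝ), 0 ≤ 1 - Real.exp (-(c * (v : ℝ))) := fun v => by
    have := v.2.out.le
    have : 0 ≤ c * (v : ℝ) := by positivity
    simp [this]
  have hint' : Integrable (fun v : Ioi (0 : ℝ) => 1 - Real.exp (-(c * (v : ℝ)))) (ν y) := by
    refine ⟨(by fun_prop : Measurable _).aestronglyMeasurable, ?_⟩
    rw [hasFiniteIntegral_iff_ofReal (ae_of_all _ hnn)]
    simpa only [hone] using hν.exponent_lt_top c y
  rw [lintegral_congr_ae h1, ← ofReal_integral_eq_lintegral_ofReal hint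
    (ae_of_all _ fun _ => (Real.exp_pos _).le), hν.laplace y c c.coe_nonneg]
  simp only [hone]
  rw [← ofReal_integral_eq_lintegral_ofReal hint' (ae_of_all _ hnn),
    expNeg_ofReal (integral_nonneg hnn)]

lemma laplace_Iic [IsProbabilityMeasure P] (hL : IsIncreasingAdditive P L)
    (hν : HasLevyMeasures P L ν) (hνt : IsPoissonIntensity ν α νt)
    (hκ : IsRandomMeasureVersion P L α κ) (c : ℝ≥0) (x : ℝ) :
    ∫⁻ ω, expNeg (c * κ ω (Iic x)) ∂P = expNeg (exponentOn νt c (Iic x)) := by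
  rw [hνt.exponentOn_Iic, ← lintegral_expNeg_eq hL hν]
  refine lintegral_congr_ae ?_
  filter_upwards [hκ.ae_Iic] with ω hω
  rw [hω, timeChange]

lemma IsRandomMeasureVersion.measurable_coe (hκ : IsRandomMeasureVersion P L α κ) {s : Set ℝ}
    (hs : MeasurableSet s) : Measurable fun ω => κ ω s :=
  (Measure.measurable_coe hs).comp hκ.measurable

/-- By independence the transform on `Iic b` is the product of those on `Iic a` and `Ioc a b`. The
exponent is additive, and the factor of `Iic a` cancels because its exponent is finite. -/
lemma laplace_Ioc [IsProbabilityMeasure P] [IsFiniteMeasure α] (hL : IsIncreasingAdditive P L)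
    (hν : HasLevyMeasures P L ν) (hνt : IsPoissonIntensity ν α νt)
    (hκ : IsRandomMeasureVersion P L α κ) (c : ℝ≥0) {a b : ℝ} (hab : a ≤ b) :
    ∫⁻ ω, expNeg (c * κ ω (Ioc a b)) ∂P = expNeg (exponentOn νt c (Ioc a b)) := by
  have hind : IndepFun (fun ω => expNeg (c * ENNReal.ofReal (L (distFun α a) ω)))
      (fun ω => expNeg (c * ENNReal.ofReal (L (distFun α b) ω - L (distFun α a) ω))) P :=
    (hL.indep.indepFun_eval_sub (zero_le : 0 ≤ distFun α a) (monotone_distFun α hab)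
      hL.start).comp (φ := fun x => expNeg (c * ENNReal.ofReal x))
      (ψ := fun x => expNeg (c * ENNReal.ofReal x))
      (measurable_expNeg.comp (measurable_const.mul measurable_id.ennreal_ofReal))
      (measurable_expNeg.comp (measurable_const.mul measurable_id.ennreal_ofReal))
  have hprod := lintegral_mul_eq_lintegral_mul_lintegral_of_indepFun
    (measurable_expNeg.comp (measurable_const.mul (hL.measurable _).ennreal_ofReal))
    (measurable_expNeg.comp (measurable_const.mul
      ((hL.measurable _).sub (hL.measurable _)).ennreal_ofReal)) hind
  have h1 : ∫⁻ ω, expNeg (c * κ ω (Iic b)) ∂P =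
      (∫⁻ ω, expNeg (c * κ ω (Iic a)) ∂P) * ∫⁻ ω, expNeg (c * κ ω (Ioc a b)) ∂P := by
    have ha : ∀ᵐ ω ∂P, expNeg (c * κ ω (Iic a)) =
        expNeg (c * ENNReal.ofReal (L (distFun α a) ω)) := by
      filter_upwards [hκ.ae_Iic] with ω hω
      rw [hω, timeChange]
    have hb : ∀ᵐ ω ∂P, expNeg (c * κ ω (Ioc a b)) =
        expNeg (c * ENNReal.ofReal (L (distFun α b) ω - L (distFun α a) ω)) := by
      filter_upwards [hκ.ae_Ioc] with ω hω
      rw [hω, timeChange, timeChange]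
    rw [lintegral_congr_ae ha, lintegral_congr_ae hb]
    refine Eq.trans ?_ hprod
    refine lintegral_congr_ae ?_
    filter_upwards [ha, hb] with ω h1 h2
    rw [Pi.mul_apply, Function.comp_apply] at *
    rw [← Iic_union_Ioc_eq_Iic hab, measure_union (Iic_disjoint_Ioc le_rfl) measurableSet_Ioc,
      mul_add, expNeg_add, h1, h2]
    rfl
  have h2 : exponentOn νt c (Iic b) = exponentOn νt c (Iic a) + exponentOn νt c (Ioc a b) := by
    rw [← Iic_union_Ioc_eq_Iic hab,
      exponentOn_union c measurableSet_Ioc (Iic_disjoint_Ioc le_rfl)]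
  have h3 : expNeg (exponentOn νt c (Iic a)) ≠ 0 := by
    rw [Ne, expNeg_eq_zero_iff, hνt.exponentOn_Iic]
    exact (hν.exponent_lt_top _ _).ne
  rw [laplace_Iic hL hν hνt hκ, laplace_Iic hL hν hνt hκ, h2, expNeg_add] at h1
  exact ((ENNReal.mul_right_inj h3 (expNeg_ne_top _)).1 h1).symm

lemma laplace_step [IsProbabilityMeasure P] [IsFiniteMeasure α] (hL : IsIncreasingAdditive P L)
    (hν : HasLevyMeasures P L ν) (hνt : IsPoissonIntensity ν α νt)
    (hκ : IsRandomMeasureVersion P L α κ) {t : ℕ → ℝ} (ht : Monotone t) (c : ℕ → ℝ≥0) (m : ℕ) :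
    ∫⁻ ω, expNeg (∑ i ∈ Finset.range m, c i * κ ω (Ioc (t i) (t (i + 1)))) ∂P =
      expNeg (∑ i ∈ Finset.range m, exponentOn νt (c i) (Ioc (t i) (t (i + 1)))) := by
  have hmeas : ∀ i, Measurable fun x : ℝ => expNeg (c i * ENNReal.ofReal x) := fun i =>
    measurable_expNeg.comp (measurable_const.mul measurable_id.ennreal_ofReal)
  have hind := (hL.indep.nat (t := fun i => distFun α (t i))
    ((monotone_distFun α).comp ht)).comp (fun i x => expNeg (c i * ENNReal.ofReal x)) hmeas
  have hprod := lintegral_prod_eq_prod_lintegral_of_indepFun (Finset.range m) _ hind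
    (fun i => (hmeas i).comp ((hL.measurable _).sub (hL.measurable _)))
  have hae : ∀ᵐ ω ∂P, ∀ i, expNeg (c i * κ ω (Ioc (t i) (t (i + 1)))) =
      expNeg (c i * ENNReal.ofReal (L (distFun α (t (i + 1))) ω - L (distFun α (t i)) ω)) := by
    filter_upwards [hκ.ae_Ioc] with ω hω i
    rw [hω, timeChange, timeChange]
  simp only [expNeg_sum]
  calc _ = ∏ i ∈ Finset.range m, ∫⁻ ω, expNeg (c i * κ ω (Ioc (t i) (t (i + 1)))) ∂P := by
        rw [Finset.prod_congr rfl fun i _ =>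
          lintegral_congr_ae (hae.mono fun ω hω => hω i)]
        refine Eq.trans (lintegral_congr_ae ?_) hprod
        filter_upwards [hae] with ω hω
        exact Finset.prod_congr rfl fun i _ => hω i
    _ = _ := Finset.prod_congr rfl fun i _ =>
        laplace_Ioc hL hν hνt hκ (c i) (ht i.le_succ)

/-- The Laplace transform of the total mass; in particular the exponent is finite. -/
lemma laplace_univ [IsProbabilityMeasure P] (hL : IsIncreasingAdditive P L)
    (hν : HasLevyMeasures P L ν) (hνt : IsPoissonIntensity ν α νt)
    (hκ : IsRandomMeasureVersion P L α κ) (c : ℝ≥0) :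
    ∫⁻ ω, expNeg (c * κ ω univ) ∂P = expNeg (exponentOn νt c univ) := by
  have h1 : Tendsto (fun n : ℕ => ∫⁻ ω, expNeg (c * κ ω (Iic (n : ℝ))) ∂P) atTop
      (𝓝 (∫⁻ ω, expNeg (c * κ ω univ) ∂P)) := by
    refine tendsto_lintegral_of_dominated_convergence (fun _ => 1)
      (fun n => measurable_expNeg.comp ((hκ.measurable_coe measurableSet_Iic).const_mul _))
      (fun n => ae_of_all _ fun ω => expNeg_le_one _) (by simp) (ae_of_all _ fun ω => ?_)
    refine (continuous_expNeg.tendsto _).comp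
      (ENNReal.Tendsto.const_mul ?_ (Or.inr ENNReal.coe_ne_top))
    exact (tendsto_measure_Iic_atTop (κ ω)).comp tendsto_natCast_atTop_atTop
  have h2 : Tendsto (fun n : ℕ => exponentOn νt c (Iic (n : ℝ))) atTop
      (𝓝 (exponentOn νt c univ)) := by
    -- As a function of the set, the exponent is the value of a measure, so continuity from below
    -- applies.
    let ρ := νt.withDensity fun p => oneSubExpNeg (ENNReal.ofReal (p.2 : ℝ) * c)
    have hρ : ∀ B, MeasurableSet B → exponentOn νt c B = ρ (B ×ˢ univ) := fun B hB =>
      (withDensity_apply _ (hB.prod MeasurableSet.univ)).symm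
    have hU : (univ : Set ℝ) ×ˢ (univ : Set (Ioi (0 : ℝ))) = ⋃ n : ℕ, Iic (n : ℝ) ×ˢ univ := by
      ext p
      simpa using exists_nat_ge p.1
    rw [hρ _ MeasurableSet.univ, hU]
    simp only [hρ _ measurableSet_Iic]
    exact tendsto_measure_iUnion_atTop fun i j h =>
      prod_mono (Iic_subset_Iic.2 (by exact_mod_cast h)) le_rfl
  simp only [laplace_Iic hL hν hνt hκ] at h1
  exact tendsto_nhds_unique h1 ((continuous_expNeg.tendsto _).comp h2)

lemma exponentOn_univ_lt_top [IsProbabilityMeasure P] (hL : IsIncreasingAdditive P L)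
    (hν : HasLevyMeasures P L ν) (hνt : IsPoissonIntensity ν α νt)
    (hκ : IsRandomMeasureVersion P L α κ) (c : ℝ≥0) : exponentOn νt c univ < ∞ := by
  have hm : Measurable fun ω => expNeg (c * κ ω univ) :=
    measurable_expNeg.comp ((hκ.measurable_coe MeasurableSet.univ).const_mul _)
  -- An infinite exponent would mean exp(-c κ(ℝ)) = 0 almost surely, although κ(ℝ) is finite.
  rw [lt_top_iff_ne_top, Ne, ← expNeg_eq_zero_iff, ← laplace_univ hL hν hνt hκ,
    lintegral_eq_zero_iff hm]
  intro h
  obtain ⟨ω, hω⟩ := h.exists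
  have := hκ.finite ω
  exact ENNReal.mul_ne_top ENNReal.coe_ne_top (measure_ne_top _ _) (expNeg_eq_zero_iff.1 hω)

end

/-! ### Approximation by step functions -/

section

/-- The step function with value `c i` on `(t i, t (i + 1)]` for `i < m`. -/
def stepFun (t : ℕ → ℝ) (c : ℕ → ℝ≥0) (m : ℕ) (x : ℝ) : ℝ≥0∞ :=
  ∑ i ∈ Finset.range m, (Ioc (t i) (t (i + 1))).indicator (fun _ => (c i : ℝ≥0∞)) x

lemma sum_indicator_Ioc_eq {t : ℕ → ℝ} (ht : Monotone t) (c : ℕ → ℝ≥0∞) {m j : ℕ} (hj : j < m)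
    {x : ℝ} (hx : x ∈ Ioc (t j) (t (j + 1))) :
    ∑ i ∈ Finset.range m, (Ioc (t i) (t (i + 1))).indicator (fun _ => c i) x = c j := by
  rw [Finset.sum_eq_single j, indicator_of_mem hx]
  · intro i _ hij
    refine indicator_of_notMem (fun hxi => ?_) _
    exact (disjoint_left.1 (ht.pairwise_disjoint_on_Ioc_succ hij)) hxi hx
  · intro h
    exact absurd (Finset.mem_range.2 hj) h

lemma stepFun_eq {t : ℕ → ℝ} (ht : Monotone t) (c : ℕ → ℝ≥0) {m j : ℕ} (hj : j < m)
    {x : ℝ} (hx : x ∈ Ioc (t j) (t (j + 1))) : stepFun t c m x = c j :=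
  sum_indicator_Ioc_eq ht (fun i => (c i : ℝ≥0∞)) hj hx

lemma comp_stepFun {t : ℕ → ℝ} (ht : Monotone t) (c : ℕ → ℝ≥0) (m : ℕ) {G : ℝ≥0∞ → ℝ≥0∞}
    (hG : G 0 = 0) (x : ℝ) :
    G (stepFun t c m x) =
      ∑ i ∈ Finset.range m, (Ioc (t i) (t (i + 1))).indicator (fun _ => G (c i)) x := by
  by_cases h : ∃ j < m, x ∈ Ioc (t j) (t (j + 1))
  · obtain ⟨j, hj, hx⟩ := h
    rw [stepFun_eq ht c hj hx, sum_indicator_Ioc_eq ht (fun i => G (c i)) hj hx]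
  · have h' : ∀ i ∈ Finset.range m, x ∉ Ioc (t i) (t (i + 1)) := fun i hi hx =>
      h ⟨i, Finset.mem_range.1 hi, hx⟩
    rw [stepFun, Finset.sum_eq_zero fun i hi => indicator_of_notMem (h' i hi) _, hG,
      Finset.sum_eq_zero fun i hi => indicator_of_notMem (h' i hi) _]

lemma measurable_stepFun (t : ℕ → ℝ) (c : ℕ → ℝ≥0) (m : ℕ) : Measurable (stepFun t c m) :=
  Finset.measurable_fun_sum _ fun _ _ => measurable_const.indicator measurableSet_Ioc

lemma lintegral_stepFun (t : ℕ → ℝ) (c : ℕ → ℝ≥0) (m : ℕ) (μ : Measure ℝ) :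
    ∫⁻ x, stepFun t c m x ∂μ = ∑ i ∈ Finset.range m, c i * μ (Ioc (t i) (t (i + 1))) := by
  simp only [stepFun]
  rw [lintegral_finsetSum _ fun _ _ => measurable_const.indicator measurableSet_Ioc]
  exact Finset.sum_congr rfl fun i _ => lintegral_indicator_const measurableSet_Ioc _

lemma laplaceExponent_stepFun (νt : Measure (ℝ × Ioi (0 : ℝ))) {t : ℕ → ℝ} (ht : Monotone t)
    (c : ℕ → ℝ≥0) (m : ℕ) :
    laplaceExponent νt (stepFun t c m) =
      ∑ i ∈ Finset.range m, exponentOn νt (c i) (Ioc (t i) (t (i + 1))) := by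
  have h : ∀ p : ℝ × Ioi (0 : ℝ),
      oneSubExpNeg (ENNReal.ofReal (p.2 : ℝ) * stepFun t c m p.1) =
        ∑ i ∈ Finset.range m, (Ioc (t i) (t (i + 1)) ×ˢ univ).indicator
          (fun q : ℝ × Ioi (0 : ℝ) => oneSubExpNeg (ENNReal.ofReal (q.2 : ℝ) * c i)) p := by
    intro p
    rw [comp_stepFun ht c m (G := fun u => oneSubExpNeg (ENNReal.ofReal (p.2 : ℝ) * u))
      (by simp [oneSubExpNeg_zero])]
    refine Finset.sum_congr rfl fun i _ => ?_
    simp [indicator]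
  simp only [laplaceExponent, h]
  rw [lintegral_finsetSum _ fun i _ => (measurable_oneSubExpNeg_mul_const _).indicator
    (measurableSet_Ioc.prod MeasurableSet.univ)]
  exact Finset.sum_congr rfl fun i _ =>
    lintegral_indicator (measurableSet_Ioc.prod MeasurableSet.univ) _

/-- The approximation of a function on `(-N, N]`, `N = n + 1`, by a step function of mesh
`1 / N`. -/
def stepApprox (f : ℝ → ℝ≥0) (n : ℕ) : ℝ → ℝ≥0∞ :=
  stepFun (fun i => -(n + 1 : ℝ) + i / (n + 1)) (fun i => f (-(n + 1 : ℝ) + (i + 1 : ℕ) / (n + 1)))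
    (2 * (n + 1) ^ 2)

lemma monotone_grid (n : ℕ) : Monotone fun i : ℕ => -(n + 1 : ℝ) + i / (n + 1) := by
  intro i j h
  have : (i : ℝ) ≤ j := by exact_mod_cast h
  dsimp only
  gcongr

lemma exists_stepApprox_eq (f : ℝ → ℝ≥0) (n : ℕ) {x : ℝ} (h1 : -(n + 1 : ℝ) < x)
    (h2 : x ≤ n + 1) : ∃ y, x ≤ y ∧ y ≤ x + 1 / (n + 1) ∧ stepApprox f n x = f y := by
  have hN : (0 : ℝ) < n + 1 := by positivity
  have hu : 0 < (x + (n + 1)) * (n + 1) := mul_pos (by linarith) hN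
  -- Cells are open on the left and closed on the right, so the cell index is the ceiling minus one;
  -- the sampling point `y` is the right endpoint of the cell.
  obtain ⟨j, hj⟩ : ∃ j, ⌈(x + (n + 1)) * (n + 1)⌉₊ = j + 1 :=
    Nat.exists_eq_succ_of_ne_zero (Nat.ceil_pos.2 hu).ne'
  have hle : (x + (n + 1)) * (n + 1) ≤ (j + 1 : ℕ) := hj ▸ Nat.le_ceil _
  have hlt : (j : ℝ) < (x + (n + 1)) * (n + 1) := by
    have := Nat.ceil_lt_add_one hu.le
    rw [hj] at this
    push_cast at this
    linarith
  have hjm : j < 2 * (n + 1) ^ 2 := by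
    have : (j : ℝ) < 2 * (n + 1) ^ 2 := by nlinarith
    exact_mod_cast this
  have hA : -(n + 1 : ℝ) + j / (n + 1) < x := by
    have := (div_lt_iff₀ hN).2 hlt
    linarith
  have hB : x ≤ -(n + 1 : ℝ) + (j + 1 : ℕ) / (n + 1) := by
    have := (le_div_iff₀ hN).2 hle
    linarith
  refine ⟨-(n + 1 : ℝ) + (j + 1 : ℕ) / (n + 1), hB, ?_, ?_⟩
  · push_cast
    rw [add_div]
    linarith
  · exact stepFun_eq (monotone_grid n) _ hjm ⟨hA, hB⟩

lemma tendsto_stepApprox {f : ℝ → ℝ≥0} (hf : Continuous f) (x : ℝ) :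
    Tendsto (fun n => stepApprox f n x) atTop (𝓝 (f x)) := by
  have hf' : Continuous fun y => (f y : ℝ≥0∞) := ENNReal.continuous_coe.comp hf
  intro U hU
  obtain ⟨δ, hδ, hball⟩ := Metric.mem_nhds_iff.1 (hf'.continuousAt (x := x) hU)
  obtain ⟨M, hM⟩ := exists_nat_gt |x|
  have hsmall := (tendsto_one_div_add_atTop_nhds_zero_nat (𝕜 := ℝ)).eventually (gt_mem_nhds hδ)
  change ∀ᶠ n in atTop, stepApprox f n x ∈ U
  filter_upwards [hsmall, eventually_ge_atTop M] with n hn hnM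
  have hMn : (M : ℝ) ≤ n := by exact_mod_cast hnM
  obtain ⟨y, hy1, hy2, hy3⟩ := exists_stepApprox_eq f n (x := x)
    (by linarith [neg_abs_le x]) (by linarith [le_abs_self x])
  rw [hy3]
  refine hball ?_
  rw [Metric.mem_ball, Real.dist_eq, abs_of_nonneg (by linarith)]
  linarith

lemma stepApprox_le {f : ℝ → ℝ≥0} {C : ℝ≥0} (hf : ∀ x, f x ≤ C) (n : ℕ) (x : ℝ) :
    stepApprox f n x ≤ C := by
  by_cases h : ∃ j < 2 * (n + 1) ^ 2, x ∈
      Ioc (-(n + 1 : ℝ) + j / (n + 1)) (-(n + 1 : ℝ) + (j + 1 : ℕ) / (n + 1))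
  · obtain ⟨j, hj, hx⟩ := h
    rw [stepApprox, stepFun_eq (monotone_grid n) _ hj hx]
    exact_mod_cast hf _
  · rw [stepApprox, stepFun, Finset.sum_eq_zero]
    · exact zero_le
    · exact fun i hi => indicator_of_notMem (fun hx => h ⟨i, Finset.mem_range.1 hi, hx⟩) _

end

/-! ### The Laplace functional -/

section

variable {Ω : Type*} [MeasurableSpace Ω] {P : Measure Ω} {L : ℝ≥0 → Ω → ℝ}
  {ν : ℝ≥0 → Measure (Ioi (0 : ℝ))} {α : Measure ℝ} {νt : Measure (ℝ × Ioi (0 : ℝ))}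
  {κ : Ω → Measure ℝ}

/-- The Laplace functional identity `E exp (-∫ f dκ) = exp (-∫ (1 - exp (-v f(x))) νt(dx dv))`. -/
def LaplaceIdentity (P : Measure Ω) (κ : Ω → Measure ℝ) (νt : Measure (ℝ × Ioi (0 : ℝ)))
    (f : ℝ → ℝ≥0∞) : Prop :=
  ∫⁻ ω, expNeg (∫⁻ x, f x ∂κ ω) ∂P = expNeg (laplaceExponent νt f)

lemma measurable_lintegral_of_measurable (hκ : Measurable κ) {f : ℝ → ℝ≥0∞} (hf : Measurable f) :
    Measurable fun ω => ∫⁻ x, f x ∂κ ω :=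
  (Measure.measurable_lintegral hf).comp hκ

lemma exponentOn_univ (c : ℝ≥0) :
    exponentOn νt c univ = ∫⁻ p, oneSubExpNeg (ENNReal.ofReal (p.2 : ℝ) * c) ∂νt := by
  rw [exponentOn, univ_prod_univ, Measure.restrict_univ]

/-- Dominated convergence on both sides: the constant `C` is κ-integrable, and the exponent of `C`
is finite. Convergence is required only almost everywhere on each side, as needed for approximation
by continuous functions. -/
lemma LaplaceIdentity.of_tendsto [IsProbabilityMeasure P] (hκ : Measurable κ)
    (hfin : ∀ ω, IsFiniteMeasure (κ ω)) (hexp : ∀ c, exponentOn νt c univ < ∞)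
    {F : ℕ → ℝ → ℝ≥0∞} {f : ℝ → ℝ≥0∞} (hF : ∀ n, Measurable (F n)) (C : ℝ≥0)
    (hC : ∀ n x, F n x ≤ C)
    (h1 : ∀ᵐ ω ∂P, ∀ᵐ x ∂κ ω, Tendsto (fun n => F n x) atTop (𝓝 (f x)))
    (h2 : ∀ᵐ p ∂νt, Tendsto (fun n => F n p.1) atTop (𝓝 (f p.1)))
    (hid : ∀ n, LaplaceIdentity P κ νt (F n)) : LaplaceIdentity P κ νt f := by
  have hleft : Tendsto (fun n => ∫⁻ ω, expNeg (∫⁻ x, F n x ∂κ ω) ∂P) atTop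
      (𝓝 (∫⁻ ω, expNeg (∫⁻ x, f x ∂κ ω) ∂P)) := by
    refine tendsto_lintegral_of_dominated_convergence (fun _ => 1)
      (fun n => measurable_expNeg.comp (measurable_lintegral_of_measurable hκ (hF n)))
      (fun n => ae_of_all _ fun ω => expNeg_le_one _) (by simp) ?_
    filter_upwards [h1] with ω hω
    refine (continuous_expNeg.tendsto _).comp
      (tendsto_lintegral_of_dominated_convergence (fun _ => (C : ℝ≥0∞)) hF
        (fun n => ae_of_all _ (hC n)) ?_ hω)
    rw [lintegral_const]
    exact ENNReal.mul_ne_top ENNReal.coe_ne_top (measure_ne_top _ _)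
  have hright : Tendsto (fun n => laplaceExponent νt (F n)) atTop (𝓝 (laplaceExponent νt f)) := by
    refine tendsto_lintegral_of_dominated_convergence
      (fun p => oneSubExpNeg (ENNReal.ofReal (p.2 : ℝ) * C))
      (fun n => measurable_oneSubExpNeg_mul (hF n))
      (fun n => ae_of_all _ fun p => monotone_oneSubExpNeg (by gcongr; exact hC n _))
      (by rw [← exponentOn_univ]; exact (hexp C).ne) ?_
    filter_upwards [h2] with p hp
    exact (continuous_oneSubExpNeg.tendsto _).comp
      (ENNReal.Tendsto.const_mul hp (Or.inr ENNReal.ofReal_ne_top))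
  simp only [LaplaceIdentity] at hid
  simp only [hid] at hleft
  exact tendsto_nhds_unique hleft ((continuous_expNeg.tendsto _).comp hright)

/-- A finite measure dominating almost every realization of `κ` and the projection of `νt`. -/
def controlMeasure (P : Measure Ω) (κ : Ω → Measure ℝ) (νt : Measure (ℝ × Ioi (0 : ℝ))) :
    Measure ℝ :=
  (P.withDensity fun ω => expNeg (κ ω univ)).bind κ +
    (νt.withDensity fun p => oneSubExpNeg (ENNReal.ofReal (p.2 : ℝ) * (1 : ℝ≥0))).map Prod.fst

/-- κ(ℝ) may have infinite mean, but with the weight exp(-κ(ℝ)) its integral is at most 1, since u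
e^{-u} ≤ 1. -/
lemma isFiniteMeasure_controlMeasure [IsProbabilityMeasure P] (hκ : Measurable κ)
    (hexp : exponentOn νt 1 univ < ∞) : IsFiniteMeasure (controlMeasure P κ νt) := by
  have hm : Measurable fun ω => κ ω univ := (Measure.measurable_coe MeasurableSet.univ).comp hκ
  have hm' : Measurable fun ω => expNeg (κ ω univ) := measurable_expNeg.comp hm
  refine ⟨?_⟩
  rw [controlMeasure, Measure.add_apply, ENNReal.add_lt_top]
  constructor
  · rw [Measure.bind_apply MeasurableSet.univ hκ.aemeasurable,
      lintegral_withDensity_eq_lintegral_mul _ hm' hm]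
    refine lt_of_le_of_lt (lintegral_mono (g := fun _ => 1) fun ω => ?_) (by simp)
    rw [Pi.mul_apply, mul_comm]
    exact (mul_expNeg_le_oneSubExpNeg _).trans (oneSubExpNeg_le_one _)
  · rw [Measure.map_apply measurable_fst MeasurableSet.univ, preimage_univ,
      withDensity_apply _ MeasurableSet.univ, Measure.restrict_univ, ← exponentOn_univ]
    exact hexp

/-- The weight exp(-κ(ℝ)) vanishes nowhere, so it hides no exceptional ω. -/
lemma ae_ae_of_ae_controlMeasure (hκ : Measurable κ) (hfin : ∀ ω, IsFiniteMeasure (κ ω))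
    {p : ℝ → Prop} (h : ∀ᵐ x ∂controlMeasure P κ νt, p x) : ∀ᵐ ω ∂P, ∀ᵐ x ∂κ ω, p x := by
  rw [controlMeasure, ae_add_measure_iff] at h
  have hm : Measurable fun ω => κ ω univ := (Measure.measurable_coe MeasurableSet.univ).comp hκ
  have h' := Measure.ae_ae_of_ae_bind hκ.aemeasurable h.1
  have hm' : Measurable fun ω => expNeg (κ ω univ) := measurable_expNeg.comp hm
  rw [ae_withDensity_iff hm'] at h'
  filter_upwards [h'] with ω hω
  exact hω fun h0 => measure_ne_top (κ ω) univ (expNeg_eq_zero_iff.1 h0)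

/-- The density 1 - e^{-v} is positive because v > 0. -/
lemma ae_fst_of_ae_controlMeasure {p : ℝ → Prop}
    (h : ∀ᵐ x ∂controlMeasure P κ νt, p x) : ∀ᵐ q ∂νt, p q.1 := by
  rw [controlMeasure, ae_add_measure_iff] at h
  have h' := ae_of_ae_map measurable_fst.aemeasurable h.2
  rw [ae_withDensity_iff (measurable_oneSubExpNeg_mul_const _)] at h'
  filter_upwards [h'] with q hq
  refine hq fun h0 => ?_
  have hq2 : 0 < (q.2 : ℝ) := q.2.2
  have h1 := mul_expNeg_le_oneSubExpNeg (ENNReal.ofReal (q.2 : ℝ) * (1 : ℝ≥0))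
  rw [h0, nonpos_iff_eq_zero, mul_eq_zero, expNeg_eq_zero_iff] at h1
  simp at h1
  linarith

lemma laplaceIdentity_of_continuous [IsProbabilityMeasure P] [IsFiniteMeasure α]
    (hL : IsIncreasingAdditive P L) (hν : HasLevyMeasures P L ν)
    (hνt : IsPoissonIntensity ν α νt) (hκ : IsRandomMeasureVersion P L α κ)
    {f : ℝ → ℝ≥0} (hf : Continuous f) (C : ℝ≥0) (hC : ∀ x, f x ≤ C) :
    LaplaceIdentity P κ νt fun x => f x := by
  refine LaplaceIdentity.of_tendsto hκ.measurable hκ.finite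
    (exponentOn_univ_lt_top hL hν hνt hκ) (F := stepApprox f)
    (fun n => measurable_stepFun _ _ _) C (stepApprox_le hC)
    (ae_of_all _ fun _ => ae_of_all _ (tendsto_stepApprox hf))
    (ae_of_all _ fun p => tendsto_stepApprox hf p.1) fun n => ?_
  rw [LaplaceIdentity, stepApprox, laplaceExponent_stepFun νt (monotone_grid n)]
  simp only [lintegral_stepFun]
  exact laplace_step hL hν hνt hκ (monotone_grid n) _ _

/-- A bounded measurable function is the almost everywhere limit, for a finite measure, of
uniformly bounded continuous functions. -/
lemma exists_continuous_tendsto_ae (ρ : Measure ℝ) [IsFiniteMeasure ρ] {f : ℝ → ℝ≥0}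
    (hf : Measurable f) {C : ℝ≥0} (hC : ∀ x, f x ≤ C) :
    ∃ F : ℕ → ℝ → ℝ≥0, (∀ n, Continuous (F n)) ∧ (∀ n x, F n x ≤ C) ∧
      ∀ᵐ x ∂ρ, Tendsto (fun n => F n x) atTop (𝓝 (f x)) := by
  have hfm : MemLp (fun x => (f x : ℝ)) 1 ρ :=
    MemLp.of_bound hf.coe_nnreal_real.aestronglyMeasurable C
      (ae_of_all _ fun x => by simpa using hC x)
  have hex : ∀ n : ℕ, ∃ g : BoundedContinuousFunction ℝ ℝ,
      eLpNorm ((fun x => (f x : ℝ)) - (g : ℝ → ℝ)) 1 ρ ≤ ENNReal.ofReal (1 / (n + 1)) ∧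
        MemLp g 1 ρ := fun n =>
    hfm.exists_boundedContinuous_eLpNorm_sub_le ENNReal.one_ne_top
      (by simpa using (by positivity : (0 : ℝ) < n + 1))
  choose g hg hgm using hex
  have hlim : Tendsto (fun n => eLpNorm ((g n : ℝ → ℝ) - fun x => (f x : ℝ)) 1 ρ) atTop (𝓝 0) := by
    have h0 : Tendsto (fun n : ℕ => ENNReal.ofReal (1 / ((n : ℝ) + 1))) atTop (𝓝 0) := by
      simpa using ENNReal.tendsto_ofReal (tendsto_one_div_add_atTop_nhds_zero_nat (𝕜 := ℝ))
    refine tendsto_of_tendsto_of_tendsto_of_le_of_le tendsto_const_nhds h0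
      (fun _ => zero_le) fun n => ?_
    dsimp only
    rw [eLpNorm_sub_comm]
    exact hg n
  obtain ⟨ns, -, hns⟩ := (tendstoInMeasure_of_tendsto_eLpNorm one_ne_zero
    (fun n => (hgm n).aestronglyMeasurable) hfm.aestronglyMeasurable hlim).exists_seq_tendsto_ae
  -- Clipping to [0, C] preserves continuity, makes the bound uniform, and keeps the limit because f
  -- takes values in [0, C].
  refine ⟨fun n x => min (g (ns n) x).toNNReal C, fun n =>
    (continuous_real_toNNReal.comp (g (ns n)).continuous).min continuous_const,
    fun n x => min_le_right _ _, ?_⟩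
  filter_upwards [hns] with x hx
  have h := ((continuous_real_toNNReal.tendsto _).comp hx).min
    (tendsto_const_nhds (x := C))
  simpa [min_eq_left (hC x)] using h

lemma laplaceIdentity_of_bounded [IsProbabilityMeasure P] [IsFiniteMeasure α]
    (hL : IsIncreasingAdditive P L) (hν : HasLevyMeasures P L ν)
    (hνt : IsPoissonIntensity ν α νt) (hκ : IsRandomMeasureVersion P L α κ)
    {f : ℝ → ℝ≥0} (hf : Measurable f) (C : ℝ≥0) (hC : ∀ x, f x ≤ C) :
    LaplaceIdentity P κ νt fun x => f x := by
  have hexp := exponentOn_univ_lt_top hL hν hνt hκ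
  have := isFiniteMeasure_controlMeasure (P := P) hκ.measurable (hexp 1)
  obtain ⟨F, hFc, hFC, hF⟩ := exists_continuous_tendsto_ae (controlMeasure P κ νt) hf hC
  have hF' : ∀ᵐ x ∂controlMeasure P κ νt,
      Tendsto (fun n => (F n x : ℝ≥0∞)) atTop (𝓝 (f x)) := by
    filter_upwards [hF] with x hx using ENNReal.tendsto_coe.2 hx
  exact LaplaceIdentity.of_tendsto hκ.measurable hκ.finite hexp
    (fun n => (hFc n).measurable.coe_nnreal_ennreal) C
    (fun n x => by exact_mod_cast hFC n x)
    (ae_ae_of_ae_controlMeasure hκ.measurable hκ.finite hF')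
    (ae_fst_of_ae_controlMeasure hF')
    fun n => laplaceIdentity_of_continuous hL hν hνt hκ (hFc n) C (hFC n)

/-- The Laplace functional of the random measure `dL_A`. -/
theorem laplaceIdentity [IsProbabilityMeasure P] [IsFiniteMeasure α]
    (hL : IsIncreasingAdditive P L) (hν : HasLevyMeasures P L ν)
    (hνt : IsPoissonIntensity ν α νt) (hκ : IsRandomMeasureVersion P L α κ)
    {f : ℝ → ℝ≥0∞} (hf : Measurable f) : LaplaceIdentity P κ νt f := by
  -- Truncation at level n reduces to bounded f; both inner integrals then increase to those of f,
  -- infinite values included.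
  have hmono : ∀ x, Monotone fun n : ℕ => min (f x) n := fun x i j h =>
    min_le_min le_rfl (by exact_mod_cast h)
  have hlim : ∀ x, Tendsto (fun n : ℕ => min (f x) n) atTop (𝓝 (f x)) := fun x => by
    simpa using (tendsto_const_nhds (x := f x)).min ENNReal.tendsto_nat_nhds_top
  have hmeas : ∀ n : ℕ, Measurable fun x => min (f x) n := fun n => hf.min measurable_const
  have hid : ∀ n : ℕ, LaplaceIdentity P κ νt fun x => min (f x) n := fun n => by
    have hne : ∀ x, min (f x) (n : ℝ≥0∞) ≠ ∞ := fun x =>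
      ((min_le_right _ _).trans_lt (ENNReal.natCast_lt_top n)).ne
    have h := laplaceIdentity_of_bounded hL hν hνt hκ (f := fun x => (min (f x) n).toNNReal)
      (hmeas n).ennreal_toNNReal n fun x => by
        rw [← ENNReal.coe_le_coe, ENNReal.coe_toNNReal (hne x)]
        simp
    simpa only [ENNReal.coe_toNNReal (hne _)] using h
  have hleft : Tendsto (fun n : ℕ => ∫⁻ ω, expNeg (∫⁻ x, min (f x) n ∂κ ω) ∂P) atTop
      (𝓝 (∫⁻ ω, expNeg (∫⁻ x, f x ∂κ ω) ∂P)) := by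
    refine tendsto_lintegral_of_dominated_convergence (fun _ => 1)
      (fun n => measurable_expNeg.comp
        (measurable_lintegral_of_measurable hκ.measurable (hmeas n)))
      (fun n => ae_of_all _ fun ω => expNeg_le_one _) (by simp) (ae_of_all _ fun ω => ?_)
    exact (continuous_expNeg.tendsto _).comp
      (lintegral_tendsto_of_tendsto_of_monotone (fun n => (hmeas n).aemeasurable)
        (ae_of_all _ hmono) (ae_of_all _ hlim))
  have hright : Tendsto (fun n : ℕ => laplaceExponent νt fun x => min (f x) n) atTop
      (𝓝 (laplaceExponent νt f)) := by
    refine lintegral_tendsto_of_tendsto_of_monotone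
      (fun n => (measurable_oneSubExpNeg_mul (hmeas n)).aemeasurable)
      (ae_of_all _ fun p i j h => monotone_oneSubExpNeg (mul_le_mul_right (hmono p.1 h) _))
      (ae_of_all _ fun p => ?_)
    exact (continuous_oneSubExpNeg.tendsto _).comp
      (ENNReal.Tendsto.const_mul (hlim p.1) (Or.inr ENNReal.ofReal_ne_top))
  simp only [LaplaceIdentity] at hid
  simp only [hid] at hleft
  exact tendsto_nhds_unique hleft ((continuous_expNeg.tendsto _).comp hright)

end

/-! ### Almost sure finiteness of `∫ f dL_A` -/

section

variable {Ω : Type*} [MeasurableSpace Ω] {P : Measure Ω} {L : ℝ≥0 → Ω → ℝ}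
  {ν : ℝ≥0 → Measure (Ioi (0 : ℝ))} {α : Measure ℝ} {νt : Measure (ℝ × Ioi (0 : ℝ))}
  {κ : Ω → Measure ℝ}

lemma tendsto_inv_natCast_succ :
    Tendsto (fun n : ℕ => ((n + 1 : ℕ) : ℝ≥0∞)⁻¹) atTop (𝓝 0) :=
  ENNReal.tendsto_inv_nat_nhds_zero.comp (tendsto_add_atTop_nat 1)

lemma tendsto_inv_natCast_succ_mul {u : ℝ≥0∞} (hu : u ≠ ∞) :
    Tendsto (fun n : ℕ => ((n + 1 : ℕ) : ℝ≥0∞)⁻¹ * u) atTop (𝓝 0) := by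
  simpa using ENNReal.Tendsto.mul_const tendsto_inv_natCast_succ (Or.inr hu)

/-- `∫ f dκ` is almost surely finite if and only if `f` is `νt`-almost everywhere finite with
finite Laplace exponents. -/
theorem ae_lintegral_lt_top_iff [IsProbabilityMeasure P] (hκ : Measurable κ)
    (hid : ∀ f : ℝ → ℝ≥0∞, Measurable f → LaplaceIdentity P κ νt f)
    {f : ℝ → ℝ≥0∞} (hf : Measurable f) :
    (∀ᵐ ω ∂P, ∫⁻ x, f x ∂κ ω < ∞) ↔
      (∀ᵐ p ∂νt, f p.1 < ∞) ∧ ∀ l : ℝ, 0 < l →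
        ∫⁻ p, oneSubExpNeg (ENNReal.ofReal (l * (p.2 : ℝ)) * f p.1) ∂νt < ∞ := by
  have hX : Measurable fun ω => ∫⁻ x, f x ∂κ ω := measurable_lintegral_of_measurable hκ hf
  have hidc : ∀ c : ℝ≥0∞, ∫⁻ ω, expNeg (c * ∫⁻ x, f x ∂κ ω) ∂P =
      expNeg (laplaceExponent νt fun x => c * f x) := fun c => by
    have := hid (fun x => c * f x) (hf.const_mul c)
    simpa only [LaplaceIdentity, lintegral_const_mul _ hf] using this
  have hXc : ∀ c : ℝ≥0∞, Measurable fun ω => expNeg (c * ∫⁻ x, f x ∂κ ω) := fun c =>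
    measurable_expNeg.comp (hX.const_mul c)
  have hcpos : ∀ n : ℕ, ((n + 1 : ℕ) : ℝ≥0∞)⁻¹ ≠ 0 := fun n => by simp
  constructor
  · intro h
    constructor
    -- For c > 0 the integrand of the exponent of c f equals 1 where f = ∞, so that exponent is at
    -- least νt{f = ∞}. As c → 0, E exp(-c ∫ f dκ) → 1, which forces νt{f = ∞} = 0.
    · have hle : ∀ n : ℕ, νt {p | f p.1 = ∞} ≤
          laplaceExponent νt fun x => ((n + 1 : ℕ) : ℝ≥0∞)⁻¹ * f x := fun n => by
        have hms : MeasurableSet {p : ℝ × Ioi (0 : ℝ) | f p.1 = ∞} :=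
          (hf.comp measurable_fst) (measurableSet_singleton ∞)
        rw [← lintegral_indicator_one hms]
        refine lintegral_mono fun p => ?_
        by_cases hp : f p.1 = ∞
        · have hp2 : ENNReal.ofReal (p.2 : ℝ) ≠ 0 := (ENNReal.ofReal_pos.2 p.2.2).ne'
          dsimp only
          rw [hp, ENNReal.mul_top (hcpos n), ENNReal.mul_top hp2, oneSubExpNeg_top]
          exact indicator_le_self' (fun _ _ => zero_le) p
        · rw [indicator_of_notMem (show p ∉ {p : ℝ × Ioi (0 : ℝ) | f p.1 = ∞} from hp)]
          exact zero_le
      have hlim : Tendsto (fun n : ℕ => ∫⁻ ω, expNeg (((n + 1 : ℕ) : ℝ≥0∞)⁻¹ *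
          ∫⁻ x, f x ∂κ ω) ∂P) atTop (𝓝 (∫⁻ _, 1 ∂P)) := by
        refine tendsto_lintegral_of_dominated_convergence (fun _ => 1) (fun n => hXc _)
          (fun n => ae_of_all _ fun ω => expNeg_le_one _) (by simp) ?_
        filter_upwards [h] with ω hω
        have := (continuous_expNeg.tendsto 0).comp (tendsto_inv_natCast_succ_mul hω.ne)
        rwa [expNeg_zero] at this
      have h1 : 1 ≤ expNeg (νt {p | f p.1 = ∞}) := by
        rw [lintegral_one, measure_univ] at hlim
        refine le_of_tendsto' hlim fun n => ?_
        rw [hidc]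
        exact antitone_expNeg (hle n)
      have h0 := expNeg_eq_one_iff.1 (le_antisymm (expNeg_le_one _) h1)
      rw [ae_iff]
      simpa using h0
    · intro l hl
      -- The exponential of an a.s. finite variable has positive mean, so its exponent is finite.
      have hne : ∫⁻ ω, expNeg (ENNReal.ofReal l * ∫⁻ x, f x ∂κ ω) ∂P ≠ 0 := by
        rw [Ne, lintegral_eq_zero_iff (hXc _)]
        intro h0
        obtain ⟨ω, h1, h2⟩ := (h0.and h).exists
        exact (ENNReal.mul_lt_top ENNReal.ofReal_lt_top h2).ne (expNeg_eq_zero_iff.1 h1)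
      rw [hidc, Ne, expNeg_eq_zero_iff, ← Ne, ← lt_top_iff_ne_top] at hne
      refine lt_of_le_of_lt (le_of_eq (lintegral_congr fun p => ?_)) hne
      rw [ENNReal.ofReal_mul hl.le, mul_comm (ENNReal.ofReal l), mul_assoc]
  · rintro ⟨h1, h2⟩
    -- The exponents of c f tend to 0 as c → 0: they are dominated by the case l = 1, and finiteness
    -- of f gives the pointwise limit.
    have hlim : Tendsto (fun n : ℕ => laplaceExponent νt
        fun x => ((n + 1 : ℕ) : ℝ≥0∞)⁻¹ * f x) atTop (𝓝 (∫⁻ _, 0 ∂νt)) := by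
      refine tendsto_lintegral_of_dominated_convergence
        (fun p => oneSubExpNeg (ENNReal.ofReal (1 * (p.2 : ℝ)) * f p.1))
        (fun n => measurable_oneSubExpNeg_mul (hf.const_mul _))
        (fun n => ae_of_all _ fun p => monotone_oneSubExpNeg ?_) (h2 1 one_pos).ne ?_
      · rw [one_mul]
        refine mul_le_mul_right (mul_le_of_le_one_left' ?_) _
        rw [ENNReal.inv_le_one]
        exact_mod_cast Nat.le_add_left 1 n
      · filter_upwards [h1] with p hp
        have hlim := ENNReal.Tendsto.const_mul (a := ENNReal.ofReal (p.2 : ℝ))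
          (tendsto_inv_natCast_succ_mul hp.ne) (Or.inr ENNReal.ofReal_ne_top)
        rw [mul_zero] at hlim
        have := (continuous_oneSubExpNeg.tendsto 0).comp hlim
        rwa [oneSubExpNeg_zero] at this
    rw [lintegral_zero] at hlim
    have hlim' := (continuous_expNeg.tendsto 0).comp hlim
    rw [expNeg_zero] at hlim'
    have hms : MeasurableSet {ω | ∫⁻ x, f x ∂κ ω < ∞} := hX measurableSet_Iio
    -- For every c > 0, exp(-c X) is at most the indicator of {X < ∞}, while its mean tends to 1.
    have hP : 1 ≤ P {ω | ∫⁻ x, f x ∂κ ω < ∞} := by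
      refine le_of_tendsto' hlim' fun n => ?_
      rw [Function.comp_apply, ← hidc, ← lintegral_indicator_one hms]
      refine lintegral_mono fun ω => ?_
      by_cases hω : ∫⁻ x, f x ∂κ ω < ∞
      · rw [indicator_of_mem (show ω ∈ {ω | ∫⁻ x, f x ∂κ ω < ∞} from hω)]
        exact expNeg_le_one _
      · rw [not_lt_top_iff.1 hω, ENNReal.mul_top (hcpos n), expNeg_top]
        exact zero_le
    exact (prob_compl_eq_zero_iff hms).2 (le_antisymm prob_le_one hP)

end

/-! ### Pure atomicity of `dL_A` -/

section

variable {Ω : Type*} [MeasurableSpace Ω] {P : Measure Ω} {L : ℝ≥0 → Ω → ℝ}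
  {ν : ℝ≥0 → Measure (Ioi (0 : ℝ))} {α : Measure ℝ} {νt : Measure (ℝ × Ioi (0 : ℝ))}
  {κ : Ω → Measure ℝ}

/-- The index `⌈(n + 1) x⌉` of the cell of mesh `1 / (n + 1)` containing `x`. -/
def cellIndex (n : ℕ) (x : ℝ) : ℤ := ⌈x * (n + 1)⌉

lemma measurable_cellIndex (n : ℕ) : Measurable (cellIndex n) :=
  Int.measurable_ceil.comp (measurable_id.mul_const _)

lemma cell_subset_closedBall (n : ℕ) (x : ℝ) :
    cellIndex n ⁻¹' {cellIndex n x} ⊆ Metric.closedBall x (1 / (n + 1)) := by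
  intro y hy
  have hN : (0 : ℝ) < n + 1 := by positivity
  have h : (⌈y * (n + 1)⌉ : ℝ) = ⌈x * (n + 1)⌉ :=
    congrArg Int.cast (show ⌈y * ((n : ℝ) + 1)⌉ = ⌈x * ((n : ℝ) + 1)⌉ from hy)
  rw [Metric.mem_closedBall, Real.dist_eq, le_div_iff₀ hN,
    show |y - x| * ((n : ℝ) + 1) = |(y - x) * (n + 1)| by rw [abs_mul, abs_of_pos hN], abs_le]
  have h1 := Int.le_ceil (y * ((n : ℝ) + 1))
  have h2 := Int.ceil_lt_add_one (y * ((n : ℝ) + 1))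
  have h3 := Int.le_ceil (x * ((n : ℝ) + 1))
  have h4 := Int.ceil_lt_add_one (x * ((n : ℝ) + 1))
  constructor <;> nlinarith

lemma tendsto_measure_cell (μ : Measure ℝ) [IsFiniteMeasure μ] {x : ℝ} (hx : μ {x} = 0) :
    Tendsto (fun n => μ (cellIndex n ⁻¹' {cellIndex n x})) atTop (𝓝 0) := by
  have h := tendsto_measure_iInter_atTop (μ := μ)
    (s := fun n : ℕ => Metric.closedBall x (1 / ((n : ℝ) + 1)))
    (fun _ => Metric.isClosed_closedBall.measurableSet.nullMeasurableSet)
    (fun i j hij => Metric.closedBall_subset_closedBall (Nat.one_div_le_one_div hij))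
    ⟨0, measure_ne_top _ _⟩
  have h0 : ⋂ n : ℕ, Metric.closedBall x (1 / ((n : ℝ) + 1)) = {x} := by
    ext y
    simp only [mem_iInter, Metric.mem_closedBall, mem_singleton_iff]
    constructor
    · intro hy
      exact dist_le_zero.1 (ge_of_tendsto' (tendsto_one_div_add_atTop_nhds_zero_nat (𝕜 := ℝ)) hy)
    · rintro rfl n
      rw [dist_self]
      positivity
  rw [h0, hx] at h
  exact tendsto_of_tendsto_of_tendsto_of_le_of_le tendsto_const_nhds h (fun _ => zero_le)
    fun n => measure_mono (cell_subset_closedBall n x)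

/-- The sum of `1 - exp (-l μ(I))` over the cells `I` of mesh `1 / (n + 1)`. -/
def cellSum (l : ℝ≥0) (n : ℕ) (μ : Measure ℝ) : ℝ≥0∞ :=
  ∑' j : ℤ, oneSubExpNeg (l * μ (cellIndex n ⁻¹' {j}))

lemma measurableSet_cell (n : ℕ) (j : ℤ) : MeasurableSet (cellIndex n ⁻¹' {j}) :=
  measurable_cellIndex n (measurableSet_singleton j)

lemma measurable_cellSum (hκ : Measurable κ) (l : ℝ≥0) (n : ℕ) :
    Measurable fun ω => cellSum l n (κ ω) :=
  Measurable.tsum fun j => measurable_oneSubExpNeg.comp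
    (((Measure.measurable_coe (measurableSet_cell n j)).comp hκ).const_mul _)

lemma countable_atoms (μ : Measure ℝ) [IsFiniteMeasure μ] : {x | μ {x} ≠ 0}.Countable := by
  have h := Measure.countable_meas_pos_of_disjoint_iUnion (μ := μ) (As := fun x : ℝ => {x})
    (fun x => measurableSet_singleton x) (fun x y hxy => by simpa [Function.onFun] using hxy)
  simpa only [pos_iff_ne_zero] using h

lemma measurableSet_nonAtoms (μ : Measure ℝ) [IsFiniteMeasure μ] :
    MeasurableSet {x | μ {x} = 0} := by
  have h := (countable_atoms μ).measurableSet.compl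
  have h' : {x | μ {x} ≠ 0}ᶜ = {x | μ {x} = 0} := by ext; simp
  rwa [h'] at h

/-- The integrand is constant on each cell I, so the left side is the sum of l μ(I) exp(-l μ(I));
then u e^{-u} ≤ 1 - e^{-u} applies term by term. -/
lemma mul_lintegral_le_cellSum (l : ℝ≥0) (n : ℕ) (μ : Measure ℝ) :
    l * ∫⁻ x, expNeg (l * μ (cellIndex n ⁻¹' {cellIndex n x})) ∂μ ≤ cellSum l n μ := by
  have h : ∫⁻ x, expNeg (l * μ (cellIndex n ⁻¹' {cellIndex n x})) ∂μ =
      ∑' j : ℤ, expNeg (l * μ (cellIndex n ⁻¹' {j})) * μ (cellIndex n ⁻¹' {j}) := by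
    rw [← lintegral_map (f := fun j => expNeg (l * μ (cellIndex n ⁻¹' {j})))
      measurable_from_top (measurable_cellIndex n), lintegral_countable']
    exact tsum_congr fun j => by
      rw [Measure.map_apply (measurable_cellIndex n) (measurableSet_singleton j)]
  rw [h, ← ENNReal.tsum_mul_left]
  refine ENNReal.tsum_le_tsum fun j => ?_
  rw [mul_left_comm, mul_comm (expNeg _)]
  exact mul_expNeg_le_oneSubExpNeg _

/-- At a point that is not an atom the cell mass shrinks to 0, so exp(-l μ(cell)) → 1; Fatou's lemma
and the cell-sum bound finish. -/
lemma mul_measure_nonAtoms_le (l : ℝ≥0) (μ : Measure ℝ) [IsFiniteMeasure μ] :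
    l * μ {x | μ {x} = 0} ≤ liminf (fun n => cellSum l n μ) atTop := by
  have hm : ∀ n, Measurable fun x => expNeg (l * μ (cellIndex n ⁻¹' {cellIndex n x})) := fun n =>
    (measurable_from_top (f := fun j : ℤ => expNeg (l * μ (cellIndex n ⁻¹' {j})))).comp
      (measurable_cellIndex n)
  have h1 : μ {x | μ {x} = 0} ≤
      ∫⁻ x, liminf (fun n => expNeg (l * μ (cellIndex n ⁻¹' {cellIndex n x}))) atTop ∂μ := by
    rw [← lintegral_indicator_one (measurableSet_nonAtoms μ)]
    refine lintegral_mono fun x => ?_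
    by_cases hx : μ {x} = 0
    · have hlim := (continuous_expNeg.tendsto _).comp
        (ENNReal.Tendsto.const_mul (tendsto_measure_cell μ hx)
          (Or.inr (ENNReal.coe_ne_top (r := l))))
      rw [mul_zero, expNeg_zero] at hlim
      rw [indicator_of_mem (show x ∈ {x | μ {x} = 0} from hx)]
      exact hlim.liminf_eq.ge
    · rw [indicator_of_notMem (show x ∉ {x | μ {x} = 0} from hx)]
      exact zero_le
  have hscale : ∀ n, l * ∫⁻ x, expNeg (l * μ (cellIndex n ⁻¹' {cellIndex n x})) ∂μ =
      ∫⁻ x, l * expNeg (l * μ (cellIndex n ⁻¹' {cellIndex n x})) ∂μ := fun n =>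
    (lintegral_const_mul _ (hm n)).symm
  calc l * μ {x | μ {x} = 0}
      ≤ l * liminf (fun n => ∫⁻ x, expNeg (l * μ (cellIndex n ⁻¹' {cellIndex n x})) ∂μ) atTop :=
        mul_le_mul_right (h1.trans (lintegral_liminf_le hm)) _
    _ = liminf (fun n => l * ∫⁻ x, expNeg (l * μ (cellIndex n ⁻¹' {cellIndex n x})) ∂μ) atTop :=
        (ENNReal.liminf_const_mul_of_ne_top ENNReal.coe_ne_top).symm
    _ ≤ _ := liminf_le_liminf (Eventually.of_forall fun n => mul_lintegral_le_cellSum l n μ)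

lemma laplaceExponent_indicator (l : ℝ≥0) {B : Set ℝ} (hB : MeasurableSet B) :
    laplaceExponent νt (B.indicator fun _ => (l : ℝ≥0∞)) = exponentOn νt l B := by
  rw [exponentOn, ← lintegral_indicator (hB.prod MeasurableSet.univ), laplaceExponent]
  refine lintegral_congr fun p => ?_
  by_cases hp : p.1 ∈ B <;> simp [hp, oneSubExpNeg_zero]

lemma tsum_exponentOn_cell (l : ℝ≥0) (n : ℕ) :
    ∑' j : ℤ, exponentOn νt l (cellIndex n ⁻¹' {j}) = exponentOn νt l univ := by
  let ρ := νt.withDensity fun p => oneSubExpNeg (ENNReal.ofReal (p.2 : ℝ) * l)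
  have hρ : ∀ B, MeasurableSet B → exponentOn νt l B = ρ (B ×ˢ univ) := fun B hB =>
    (withDensity_apply _ (hB.prod MeasurableSet.univ)).symm
  have hU : (univ : Set ℝ) ×ˢ (univ : Set (Ioi (0 : ℝ))) =
      ⋃ j : ℤ, (cellIndex n ⁻¹' {j}) ×ˢ univ := by
    ext p
    simp
  rw [hρ _ MeasurableSet.univ, hU, measure_iUnion _ fun j =>
    (measurableSet_cell n j).prod MeasurableSet.univ]
  · exact tsum_congr fun j => hρ _ (measurableSet_cell n j)
  · intro i j hij
    refine Disjoint.set_prod_left ?_ _ _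
    exact Disjoint.preimage _ (by simpa using hij)

/-- With ψ the exponent of l on a cell, the mean of each term is 1 - e^{-ψ} ≤ ψ, and the ψ add up to
the total exponent whatever the mesh. -/
lemma lintegral_cellSum_le [IsProbabilityMeasure P] (hκ : Measurable κ)
    (hid : ∀ f : ℝ → ℝ≥0∞, Measurable f → LaplaceIdentity P κ νt f) (l : ℝ≥0) (n : ℕ) :
    ∫⁻ ω, cellSum l n (κ ω) ∂P ≤ exponentOn νt l univ := by
  have hm : ∀ j : ℤ, Measurable fun ω => expNeg (l * κ ω (cellIndex n ⁻¹' {j})) := fun j =>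
    measurable_expNeg.comp
      (((Measure.measurable_coe (measurableSet_cell n j)).comp hκ).const_mul _)
  have hm' : ∀ j : ℤ, Measurable fun ω => oneSubExpNeg (l * κ ω (cellIndex n ⁻¹' {j})) := fun j =>
    measurable_const.sub (hm j)
  simp only [cellSum]
  rw [lintegral_tsum fun j => (hm' j).aemeasurable, ← tsum_exponentOn_cell l n]
  refine ENNReal.tsum_le_tsum fun j => ?_
  have h := hid ((cellIndex n ⁻¹' {j}).indicator fun _ => (l : ℝ≥0∞))
    (measurable_const.indicator (measurableSet_cell n j))
  rw [LaplaceIdentity, laplaceExponent_indicator l (measurableSet_cell n j)] at h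
  simp only [lintegral_indicator_const (measurableSet_cell n j)] at h
  calc ∫⁻ ω, oneSubExpNeg (l * κ ω (cellIndex n ⁻¹' {j})) ∂P
      = oneSubExpNeg (exponentOn νt l (cellIndex n ⁻¹' {j})) := by
        simp only [oneSubExpNeg_eq]
        rw [lintegral_sub (hm j), lintegral_one, measure_univ, h]
        · rw [h]; exact expNeg_ne_top _
        · exact ae_of_all _ fun ω => expNeg_le_one _
    _ ≤ _ := oneSubExpNeg_le_self _

/-- Absence of drift: (1 - e^{-nv}) / n tends to 0 and is dominated by 1 - e^{-v}. -/
lemma tendsto_exponentOn_div (hexp : exponentOn νt 1 univ < ∞) :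
    Tendsto (fun n : ℕ => ((n + 1 : ℕ) : ℝ≥0∞)⁻¹ * exponentOn νt ((n + 1 : ℕ) : ℝ≥0) univ)
      atTop (𝓝 0) := by
  have h : Tendsto (fun n : ℕ => ∫⁻ p, ((n + 1 : ℕ) : ℝ≥0∞)⁻¹ *
      oneSubExpNeg (ENNReal.ofReal (p.2 : ℝ) * (((n + 1 : ℕ) : ℝ≥0) : ℝ≥0∞)) ∂νt) atTop
      (𝓝 (∫⁻ _, 0 ∂νt)) := by
    refine tendsto_lintegral_of_dominated_convergence
      (fun p => oneSubExpNeg (ENNReal.ofReal (p.2 : ℝ) * (1 : ℝ≥0)))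
      (fun n => (measurable_oneSubExpNeg_mul_const _).const_mul _)
      (fun n => ae_of_all _ fun p => ?_) (by rw [← exponentOn_univ]; exact hexp.ne)
      (ae_of_all _ fun p => ?_)
    · rw [ENNReal.inv_mul_le_iff (by simp) (ENNReal.natCast_ne_top _), mul_comm (ENNReal.ofReal _)]
      simpa using oneSubExpNeg_natCast_mul_le (n + 1) (ENNReal.ofReal (p.2 : ℝ))
    · exact tendsto_of_tendsto_of_tendsto_of_le_of_le tendsto_const_nhds tendsto_inv_natCast_succ
        (fun _ => zero_le) fun n => mul_le_of_le_one_right' (oneSubExpNeg_le_one _)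
  rw [lintegral_zero] at h
  refine h.congr fun n => ?_
  rw [lintegral_const_mul _ (measurable_oneSubExpNeg_mul_const _), exponentOn_univ]

/-- The random measure `dL_A` is almost surely purely atomic. -/
theorem ae_ae_singleton_ne_zero [IsProbabilityMeasure P] (hκ : Measurable κ)
    (hfin : ∀ ω, IsFiniteMeasure (κ ω)) (hexp : exponentOn νt 1 univ < ∞)
    (hid : ∀ f : ℝ → ℝ≥0∞, Measurable f → LaplaceIdentity P κ νt f) :
    ∀ᵐ ω ∂P, ∀ᵐ x ∂κ ω, κ ω {x} ≠ 0 := by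
  let Y : ℕ → Ω → ℝ≥0∞ := fun m ω => ((m + 1 : ℕ) : ℝ≥0∞)⁻¹ *
    liminf (fun n => cellSum ((m + 1 : ℕ) : ℝ≥0) n (κ ω)) atTop
  have hYm : ∀ m, Measurable (Y m) := fun m =>
    (Measurable.liminf fun n => measurable_cellSum hκ _ n).const_mul _
  have hYle : ∀ m, ∫⁻ ω, Y m ω ∂P ≤
      ((m + 1 : ℕ) : ℝ≥0∞)⁻¹ * exponentOn νt ((m + 1 : ℕ) : ℝ≥0) univ := fun m => by
    rw [lintegral_const_mul _ (Measurable.liminf fun n => measurable_cellSum hκ _ n)]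
    refine mul_le_mul_right ((lintegral_liminf_le fun n => measurable_cellSum hκ _ n).trans ?_) _
    exact liminf_le_of_le (h := fun b hb => by
      obtain ⟨n, hn⟩ := hb.exists
      exact hn.trans (lintegral_cellSum_le hκ hid _ n))
  -- The infimum of the `Y m` is a measurable majorant of the diffuse mass with zero mean, so
  -- measurability of the diffuse mass in ω is not needed.
  have hzero : ∫⁻ ω, ⨅ m, Y m ω ∂P = 0 := by
    refine le_antisymm (ge_of_tendsto' (tendsto_exponentOn_div hexp) fun m => ?_) zero_le
    exact (lintegral_mono fun ω => iInf_le _ m).trans (hYle m)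
  rw [lintegral_eq_zero_iff (Measurable.iInf hYm)] at hzero
  filter_upwards [hzero] with ω hω
  have := hfin ω
  have h0 : κ ω {x | κ ω {x} = 0} ≤ ⨅ m, Y m ω := le_iInf fun m => by
    dsimp only [Y]
    rw [mul_comm, ← div_eq_mul_inv,
      ENNReal.le_div_iff_mul_le (Or.inl (by simp)) (Or.inl (ENNReal.natCast_ne_top _)), mul_comm]
    simpa using mul_measure_nonAtoms_le ((m + 1 : ℕ) : ℝ≥0) (κ ω)
  rw [hω, Pi.zero_apply, nonpos_iff_eq_zero] at h0
  simpa [ae_iff] using h0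

end

/-! ### Pathwise analysis -/

section

lemma lintegral_eq_tsum_atoms (μ : Measure ℝ) [IsFiniteMeasure μ] (hμ : ∀ᵐ x ∂μ, μ {x} ≠ 0)
    (f : ℝ → ℝ≥0∞) :
    ∫⁻ x, f x ∂μ = ∑' s : {x | μ {x} ≠ 0}, f s * μ {(s : ℝ)} := by
  have h : μ.restrict {x | μ {x} ≠ 0} = μ := Measure.restrict_eq_self_of_ae_mem hμ
  rw [← lintegral_countable f (countable_atoms μ), h]

/-- Integration against an absolutely continuous Lebesgue–Stieltjes measure. -/
lemma lintegral_lsMeasure_of_absolutelyContinuous {f : ℝ → ℝ} (hf : Monotone f)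
    (hc : ∀ x, ContinuousWithinAt f (Ici x) x) (hac : lsMeasure f ≪ volume)
    {g : ℝ → ℝ≥0∞} (hg : Measurable g) :
    ∫⁻ t, g t ∂lsMeasure f = ∫⁻ t, g t * ENNReal.ofReal (deriv f t) := by
  have hfun : (hf.stieltjesFunction : ℝ → ℝ) = f :=
    funext (stieltjesFunction_apply_of_rightCont hf hc)
  rw [lsMeasure_of_monotone hf] at hac ⊢
  rw [← Measure.withDensity_rnDeriv_eq _ _ hac,
    lintegral_withDensity_eq_lintegral_mul _ (Measure.measurable_rnDeriv _ _) hg]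
  refine lintegral_congr_ae ?_
  -- Lebesgue differentiation: the derivative of f is a.e. the Radon–Nikodym density.
  filter_upwards [hf.stieltjesFunction.ae_hasDerivAt,
    Measure.rnDeriv_lt_top hf.stieltjesFunction.measure volume] with t ht hlt
  rw [hfun] at ht
  rw [Pi.mul_apply, mul_comm, ht.deriv, ENNReal.ofReal_toReal hlt.ne]

variable {k : ℝ → ℝ → ℝ} {μ : Measure ℝ}

lemma lsMeasure_const (c : ℝ) : lsMeasure (fun _ => c) = 0 := by
  refine Measure.ext_of_Ioc _ _ fun a b _ => ?_
  rw [lsMeasure_Ioc monotone_const fun _ => continuousWithinAt_const]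
  simp

lemma continuousWithinAt_lintegral (hkm : ∀ t, Measurable (k t))
    (hrc : ∀ x t, ContinuousWithinAt (fun t => k t x) (Ici t) t)
    (hfin : ∫⁻ x, kbar k x ∂μ < ∞) (t : ℝ) :
    ContinuousWithinAt (fun t => ∫⁻ x, ENNReal.ofReal (k t x) ∂μ) (Ici t) t :=
  tendsto_lintegral_filter_of_dominated_convergence (kbar k)
    (Eventually.of_forall fun s => (hkm s).ennreal_ofReal)
    (Eventually.of_forall fun s => ae_of_all _ fun x => le_iSup (fun t => ENNReal.ofReal (k t x)) s)
    hfin.ne (ae_of_all _ fun x => (ENNReal.continuous_ofReal.tendsto _).comp (hrc x t))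

/-- The measure `dZ` is the mixture of the measures `k(dt, x)` over the atoms of `μ`. -/
lemma smul_lsMeasure_eq_sum [IsFiniteMeasure μ] (hμ : ∀ᵐ x ∂μ, μ {x} ≠ 0)
    (hkm : ∀ t, Measurable (k t)) (hmono : ∀ x, Monotone fun t => k t x)
    (hrc : ∀ x t, ContinuousWithinAt (fun t => k t x) (Ici t) t)
    (hpos : ∀ t x, 0 ≤ k t x) (hfin : ∫⁻ x, kbar k x ∂μ < ∞)
    {Z : ℝ → ℝ≥0∞} (hZ : Z = fun t => ∫⁻ x, ENNReal.ofReal (k t x) ∂μ)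
    {T : ℝ≥0∞} (hT : T = ⨆ t, Z t) :
    T • lsMeasure (fun t => (Z t / T).toReal) =
      Measure.sum fun s : {x | μ {x} ≠ 0} => μ {(s : ℝ)} • lsMeasure fun t => k t s := by
  have hZT : ∀ t, Z t ≤ T := fun t => hT ▸ le_iSup Z t
  have hTfin : T < ∞ := by
    refine lt_of_le_of_lt ?_ hfin
    rw [hT, hZ]
    exact iSup_le fun t => lintegral_mono fun x => le_iSup (fun t => ENNReal.ofReal (k t x)) t
  have hZfin : ∀ t, Z t ≠ ∞ := fun t => ((hZT t).trans_lt hTfin).ne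
  have hZmono : Monotone Z := by
    intro a b hab
    rw [hZ]
    exact lintegral_mono fun x => ENNReal.ofReal_le_ofReal (hmono x hab)
  have hdfin : ∀ t, Z t / T ≠ ∞ := fun t =>
    ((ENNReal.div_le_of_le_mul (by rw [one_mul]; exact hZT t)).trans_lt ENNReal.one_lt_top).ne
  have hFmono : Monotone fun t => (Z t / T).toReal := fun a b hab =>
    ENNReal.toReal_mono (hdfin b) (ENNReal.div_le_div_right (hZmono hab) T)
  have hFrc : ∀ t, ContinuousWithinAt (fun t => (Z t / T).toReal) (Ici t) t := fun t => by
    by_cases hT0 : T = 0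
    · have : ∀ t, Z t = 0 := fun t => le_antisymm (hT0 ▸ hZT t) zero_le
      simp only [this, ENNReal.zero_div]
      exact continuousWithinAt_const
    · refine (ENNReal.tendsto_toReal (hdfin t)).comp
        (ENNReal.Tendsto.div_const ?_ (Or.inr hT0))
      have := continuousWithinAt_lintegral hkm hrc hfin t
      rw [← hZ] at this
      exact this
  refine Measure.ext_of_Ioc' _ _ (fun a b _ => ?_) fun a b hab => ?_
  · rw [Measure.smul_apply, smul_eq_mul]
    exact ENNReal.mul_ne_top hTfin.ne measure_Ioc_lt_top.ne
  · have hsum : ∫⁻ x, ENNReal.ofReal (k b x - k a x) ∂μ = Z b - Z a := by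
      simp only [ENNReal.ofReal_sub _ (hpos a _)]
      rw [lintegral_sub (hkm a).ennreal_ofReal, hZ]
      · have := hZfin a
        rwa [hZ] at this
      · exact ae_of_all _ fun x => ENNReal.ofReal_le_ofReal (hmono x hab.le)
    rw [Measure.sum_apply _ measurableSet_Ioc, Measure.smul_apply, smul_eq_mul,
      lsMeasure_Ioc hFmono hFrc]
    simp only [Measure.smul_apply, smul_eq_mul, lsMeasure_Ioc (hmono _) (hrc _)]
    -- The sum over atoms is the integral of k(b, x) - k(a, x) against μ, since μ has no diffuse
    -- part; this integral is Z(b) - Z(a).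
    rw [tsum_congr fun s : {x | μ {x} ≠ 0} => mul_comm (μ {(s : ℝ)}) _,
      ← lintegral_eq_tsum_atoms μ hμ fun x => ENNReal.ofReal (k b x - k a x), hsum,
      ENNReal.ofReal_sub _ ENNReal.toReal_nonneg, ENNReal.ofReal_toReal (hdfin b),
      ENNReal.ofReal_toReal (hdfin a), ENNReal.mul_sub fun _ _ => hTfin.ne]
    by_cases hT0 : T = 0
    · have : ∀ t, Z t = 0 := fun t => le_antisymm (hT0 ▸ hZT t) zero_le
      simp [this]
    · rw [ENNReal.mul_div_cancel hT0 hTfin.ne, ENNReal.mul_div_cancel hT0 hTfin.ne]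

/-- Pathwise comparison: if the normalized distribution function driven by a purely atomic measure
has a density, then `∫ |g| dF` is finite if and only if `∫ hTilde dμ` is. -/
lemma lintegral_normalized_lt_top_iff [IsFiniteMeasure μ] (hμ : ∀ᵐ x ∂μ, μ {x} ≠ 0)
    (hkm : ∀ t, Measurable (k t)) (hmono : ∀ x, Monotone fun t => k t x)
    (hrc : ∀ x t, ContinuousWithinAt (fun t => k t x) (Ici t) t)
    (hpos : ∀ t x, 0 ≤ k t x) (hfin : ∫⁻ x, kbar k x ∂μ < ∞)
    {Z : ℝ → ℝ≥0∞} (hZ : Z = fun t => ∫⁻ x, ENNReal.ofReal (k t x) ∂μ)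
    {T : ℝ≥0∞} (hT : T = ⨆ t, Z t)
    (hac : lsMeasure (fun t => (Z t / T).toReal) ≪ volume)
    {g : ℝ → ℝ} (hg : Measurable g) :
    ∫⁻ t, ‖g t‖ₑ ∂(lsMeasure fun t => (Z t / T).toReal) < ∞ ↔ ∫⁻ x, hTilde k g x ∂μ < ∞ := by
  have hsum := smul_lsMeasure_eq_sum hμ hkm hmono hrc hpos hfin hZ hT
  -- The decisive use of atomicity: μ{s} k(dt, s) is one summand of T dF, and μ{s} ≠ 0, so the
  -- density of F passes to k(·, s).
  have hkac : ∀ s : {x | μ {x} ≠ 0}, lsMeasure (fun t => k t s) ≪ volume := fun s => by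
    have h1 : μ {(s : ℝ)} • lsMeasure (fun t => k t s) ≪ volume :=
      (Measure.absolutelyContinuous_of_le (hsum ▸ Measure.le_sum (fun s : {x | μ {x} ≠ 0} =>
        μ {(s : ℝ)} • lsMeasure fun t => k t s) s)).trans (hac.smul_left T)
    exact (Measure.absolutelyContinuous_smul s.2).trans h1
  have hkey : T * ∫⁻ t, ‖g t‖ₑ ∂(lsMeasure fun t => (Z t / T).toReal) =
      ∫⁻ x, hTilde k g x ∂μ := by
    rw [← smul_eq_mul, ← lintegral_smul_measure, hsum, lintegral_sum_measure,
      lintegral_eq_tsum_atoms μ hμ]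
    refine tsum_congr fun s => ?_
    rw [lintegral_smul_measure, smul_eq_mul, mul_comm, hTilde,
      lintegral_lsMeasure_of_absolutelyContinuous (hmono s) (hrc s) (hkac s) hg.enorm]
  -- The factor T can be removed only when nonzero; for T = 0 both integrals vanish.
  by_cases hT0 : T = 0
  · have hZ0 : ∀ t, Z t = 0 := fun t => le_antisymm (hT0 ▸ hT ▸ le_iSup Z t) zero_le
    rw [← hkey, hT0, zero_mul]
    simp [hZ0, lsMeasure_const]
  · have hTfin : T < ∞ := by
      refine lt_of_le_of_lt ?_ hfin
      rw [hT, hZ]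
      exact iSup_le fun t => lintegral_mono fun x => le_iSup (fun t => ENNReal.ofReal (k t x)) t
    rw [← hkey]
    refine ⟨fun h => ENNReal.mul_lt_top hTfin h, fun h => ?_⟩
    rcases ENNReal.mul_lt_top_iff.1 h with h | h | h
    · exact h.2
    · exact absurd h hT0
    · rw [h]; exact ENNReal.zero_lt_top

lemma measurable_kbar (hkm : ∀ t, Measurable (k t)) (hmono : ∀ x, Monotone fun t => k t x) :
    Measurable (kbar k) := by
  have h : kbar k = fun x => ⨆ n : ℕ, ENNReal.ofReal (k n x) := by
    funext x
    refine le_antisymm (iSup_le fun t => ?_)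
      (iSup_le fun n => le_iSup (fun t => ENNReal.ofReal (k t x)) (n : ℝ))
    obtain ⟨n, hn⟩ := exists_nat_ge t
    exact (ENNReal.ofReal_le_ofReal (hmono x hn)).trans
      (le_iSup (fun n : ℕ => ENNReal.ofReal (k n x)) n)
  rw [h]
  exact Measurable.iSup fun n => (hkm n).ennreal_ofReal

/-- A kernel that is measurable in `x` and right-continuous in `t` is jointly measurable. -/
lemma measurable_uncurry_of_rightCont (hkm : ∀ t, Measurable (k t))
    (hrc : ∀ x t, ContinuousWithinAt (fun t => k t x) (Ici t) t) :
    Measurable fun p : ℝ × ℝ => k p.1 p.2 := by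
  -- Rounding t up to the grid takes countably many values and approaches t from the right, the side
  -- on which k is continuous.
  have hm : ∀ n : ℕ, Measurable fun p : ℝ × ℝ => k (cellIndex n p.1 / (n + 1)) p.2 := fun n =>
    (measurable_from_prod_countable_right (f := fun q : ℤ × ℝ => k (q.1 / ((n : ℝ) + 1)) q.2)
      fun j => hkm (j / (n + 1))).comp (((measurable_cellIndex n).comp measurable_fst).prodMk measurable_snd)
  refine measurable_of_tendsto_metrizable hm (tendsto_pi_nhds.2 fun p => ?_)
  refine (hrc p.2 p.1).tendsto.comp (tendsto_nhdsWithin_iff.2 ⟨?_, ?_⟩)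
  · have h1 : Tendsto (fun n : ℕ => p.1 + 1 / ((n : ℝ) + 1)) atTop (𝓝 p.1) := by
      simpa using (tendsto_const_nhds (x := p.1)).add
        (tendsto_one_div_add_atTop_nhds_zero_nat (𝕜 := ℝ))
    refine tendsto_of_tendsto_of_tendsto_of_le_of_le tendsto_const_nhds h1 (fun n => ?_) fun n => ?_
    · have hN : (0 : ℝ) < n + 1 := by positivity
      exact (le_div_iff₀ hN).2 (Int.le_ceil _)
    · have hN : (0 : ℝ) < n + 1 := by positivity
      have := Int.ceil_lt_add_one (p.1 * ((n : ℝ) + 1))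
      dsimp only
      rw [div_le_iff₀ hN, add_mul, one_div, inv_mul_cancel₀ hN.ne']
      exact this.le
  · refine Eventually.of_forall fun n => ?_
    have hN : (0 : ℝ) < n + 1 := by positivity
    exact (le_div_iff₀ hN).2 (Int.le_ceil _)

/-- The derivative is replaced by a liminf of difference quotients, which is jointly measurable and
agrees with it at a.e. t, a monotone function being a.e. differentiable. -/
lemma measurable_hTilde (hkm : ∀ t, Measurable (k t)) (hmono : ∀ x, Monotone fun t => k t x)
    (hrc : ∀ x t, ContinuousWithinAt (fun t => k t x) (Ici t) t)
    {g : ℝ → ℝ} (hg : Measurable g) : Measurable (hTilde k g) := by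
  have hk := measurable_uncurry_of_rightCont hkm hrc
  let q : ℝ × ℝ → ℝ≥0∞ := fun p => liminf (fun n : ℕ =>
    ENNReal.ofReal (((n : ℝ) + 1) * (k (p.2 + 1 / ((n : ℝ) + 1)) p.1 - k p.2 p.1))) atTop
  have hq : Measurable q := Measurable.liminf fun n => by
    refine (Measurable.const_mul (Measurable.sub ?_ ?_) _).ennreal_ofReal
    · exact hk.comp ((measurable_snd.add_const _).prodMk measurable_fst)
    · exact hk.comp (measurable_snd.prodMk measurable_fst)
  have h : hTilde k g = fun x => ∫⁻ t, ‖g t‖ₑ * q (x, t) := by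
    funext x
    refine lintegral_congr_ae ?_
    filter_upwards [(hmono x).ae_differentiableAt] with t ht
    have hslope := hasDerivAt_iff_tendsto_slope_zero.1 ht.hasDerivAt
    have hseq : Tendsto (fun n : ℕ => 1 / ((n : ℝ) + 1)) atTop (𝓝[≠] 0) :=
      tendsto_nhdsWithin_iff.2 ⟨tendsto_one_div_add_atTop_nhds_zero_nat,
        Eventually.of_forall fun n => (by positivity : (1 : ℝ) / (n + 1) ≠ 0)⟩
    have hlim := ENNReal.tendsto_ofReal (hslope.comp hseq)
    congr 1
    refine Eq.symm (Eq.trans ?_ hlim.liminf_eq)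
    simp only [q, Function.comp_apply, one_div, inv_inv, smul_eq_mul]
  rw [h]
  exact ((hg.enorm.comp measurable_snd).mul hq).lintegral_prod_right'

end

end IAP

end

theorem proposition1 {Ω : Type*} [MeasurableSpace Ω] (P : Measure Ω) [IsProbabilityMeasure P]
    (L : ℝ≥0 → Ω → ℝ) (hL : IAP.IsIncreasingAdditive P L)
    (ν : ℝ≥0 → Measure (Ioi (0 : ℝ))) (hν : IAP.HasLevyMeasures P L ν)
    (α : Measure ℝ) [IsFiniteMeasure α] (hα : α ≠ 0)
    (νt : Measure (ℝ × Ioi (0 : ℝ))) (hνt : IAP.IsPoissonIntensity ν α νt)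
    (k : ℝ → ℝ → ℝ) (hk : IAP.IsAdmissible k νt)
    (hF : ∀ᵐ ω ∂P, IAP.lsMeasure (fun t => IAP.normalizedDF L α k t ω) ≪ volume)
    (g : ℝ → ℝ) (hg : Measurable g) :
    (∀ᵐ ω ∂P, ∫⁻ t, ‖g t‖ₑ ∂(IAP.lsMeasure fun t => IAP.normalizedDF L α k t ω) < ∞) ↔
      ((∀ᵐ p ∂νt, IAP.hTilde k g p.1 < ∞) ∧
        ∀ l : ℝ, 0 < l →
          ∫⁻ p, IAP.oneSubExpNeg (ENNReal.ofReal (l * (p.2 : ℝ)) * IAP.hTilde k g p.1) ∂νt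
            < ∞) := by

  obtain ⟨κ, hκ⟩ := hL.exists_version α
  have hid : ∀ f : ℝ → ℝ≥0∞, Measurable f → IAP.LaplaceIdentity P κ νt f := fun f hf =>
    IAP.laplaceIdentity hL hν hνt hκ hf
  have hatoms := IAP.ae_ae_singleton_ne_zero hκ.measurable hκ.finite
    (IAP.exponentOn_univ_lt_top hL hν hνt hκ 1) hid
  -- Condition (II) is the finiteness criterion for f = `kbar k`; it makes Zbar finite on almost
  -- every path.
  have hkbar : ∀ᵐ ω ∂P, ∫⁻ x, IAP.kbar k x ∂κ ω < ∞ :=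
    (IAP.ae_lintegral_lt_top_iff hκ.measurable hid
      (IAP.measurable_kbar hk.measurable hk.mono)).2 ⟨hk.kbar_lt_top, hk.integral_lt_top⟩
  have hpos : ∀ t x, 0 ≤ k t x := fun t x =>
    (hk.mono x).le_of_tendsto (hk.atBot x) t
  -- The same criterion for f = `hTilde k g` turns the analytic condition into a.s. finiteness of ∫
  -- f dκ, leaving a pathwise equivalence.
  rw [← IAP.ae_lintegral_lt_top_iff hκ.measurable hid
    (IAP.measurable_hTilde hk.measurable hk.mono hk.rightCont hg)]
  refine eventually_congr ?_
  filter_upwards [hatoms, hkbar, hκ.ae_eq, hF] with ω h1 h2 h3 h4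
  have := hκ.finite ω
  refine IAP.lintegral_normalized_lt_top_iff h1 hk.measurable hk.mono hk.rightCont hpos h2
    (Z := fun t => IAP.drivenDF L α k t ω) ?_ rfl h4 hg
  simp only [IAP.drivenDF, h3]
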